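/- Let $n\ge 0$, let $(W,S)$ be a Coxeter system of type $B_n$ with $S=\{s_1,\dots,s_n\}$, where $m(s_1,s_2)=4$, $m(s_i,s_{i+1})=3$ for $2\le i<n$ and $m(s_i,s_j)=2$ for $|i-j|>1$, and let $(U,T)$ be a Coxeter system of type $A_n$ with $T=\{t_1,\dots,t_n\}$, numbered along the diagram. Let $\Phi_U$ be the root system of $(U,T)$ in its standard geometric representation, and let $\Sigma(\Phi_U)$ be the commutative monoid of root subsystems of $\Phi_U$ (subsets of $\Phi_U$ stable under their own reflections), the product of two subsystems being the subsystem they generate. The group $U$ acts on $\Sigma(\Phi_U)$. Write $\langle t\rangle=\{\alpha_t,-\alpha_t\}$ for $t\in T$. A Juyumaya map $(W,S)\to(U,T)$ is a pair $(\phi,e)$, where $\phi\colon W\to U$ is a group homomorphism and $e\colon S\to\Sigma(\Phi_U)$ is a map such that $\phi(w).e_s=e_{s'}$ whenever $wsw^{-1}=s'$ with $s,s'\in S$, $w\in W$, and such that $e_s\cdot(\phi(w).e_{s'})=e_s\cdot(\phi(sw).e_{s'})$ for all $s,s'\in S$, $w\in W$. **(a)** There is exactly one Juyumaya map $(\phi,e)$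 with $\phi(s_1)=1$, $\phi(s_i)=t_i$ for $2\le i\le n$, and $e_{s_i}=\langle t_i\rangle$ for $i\le 2$. It satisfies $e_{s_i}=\langle t_i\rangle$ for all $i$. Let $R$ be a commutative ring and let $u\colon S\to R^\times$, $s_i\mapsto u_i$, be constant on $W$-conjugacy classes of elements of $S$. Let $\Sigma(\Phi_U)_{[e]}$ be the submonoid of $\Sigma(\Phi_U)$ generated by the elements $\phi(w).e_s$ ($w\in W$, $s\in S$), with the $W$-action $\rho_\phi$ through $\phi$, let $A=R[\Sigma(\Phi_U)_{[e]}]$ be its monoid algebra with the induced $W$-action, and put $\hat e_{s}=1+(u_{s}-1)e_{s}\in A^\times$. Let $B_W$ be the Artin group of $(W,S)$ with standard generators $g_s$, acting on $A$ through $B_W\to W$, and let $$\mathcal E^{(W,S)}(A,\rho_\phi,\hat e)$$ be the quotient of the $R$-algebra $A\rtimes R[B_W]$ (in which $g\,c=(g.c)\,g$ for $g\in B_W$, $c\in A$) by the two-sided ideal generated by the elements $g_s^2-\hat e_s-(1-\hat e_s)g_s$, $s\in S$. In this algebra write $g_i=g_{s_i}$, $e_i=e_{s_i}$, and let $f_1=e_1$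 and $f_i=s_i.f_{i-1}\in\Sigma(\Phi_U)_{[e]}$ for $2\le i\le n$. **(b)** The $R$-algebra $\mathcal E^{(W,S)}(A,\rho_\phi,\hat e)$ is generated by the elements $g_i,e_i,f_i$ ($1\le i\le n$). **(c)** Let $\mathcal E^B_n$ be Flores' type $B$ braids and ties algebra, that is, the $R$-algebra generated by $g_i,e_i,f_i$ ($1\le i\le n$) subject to the relations (for all indices in $\{1,\dots,n\}$ satisfying the stated conditions) \begin{align*} g_ig_j&=g_jg_i && |i-j|>1\\ g_1g_2g_1g_2&=g_2g_1g_2g_1\\ g_ig_jg_i&=g_jg_ig_j && |i-j|=1,\ \{i,j\}\ne\{1,2\}\\ g_i^2&=1+(u_i-1)e_i(1-g_i)\\ g_ie_j&=e_jg_i && |i-j|\ne1\ \text{or}\ (i,j)=(1,2)\\ g_jg_ie_j&=e_ig_jg_i && |i-j|=1,\ \{i,j\}\neq\{1,2\}\\ e_ie_j&=e_je_i\\ e_i^2&=e_i\\ e_je_ig_j&=e_ig_je_i=g_je_ie_j && |i-j|=1,\ \{i,j\}\neq\{1,2\}\\ e_1e_2g_2&=e_2g_2e_1=g_2e_1e_2\\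 f_1&=e_1\\ g_if_j&=f_jg_i && i=1,\ \text{or}\ i\ge2\ \text{and}\ j\ne i-1,i\\ e_if_j&=f_je_i\\ f_if_j&=f_jf_i\\ g_if_{i-1}&=f_ig_i && 2\le i\le n\\ g_if_i&=f_{i-1}g_i && 2\le i\le n\\ e_{i+1}f_i&=e_{i+1}f_{i+1} && 1\le i<n\\ e_{i+1}f_i&=f_{i+1}f_i && 1\le i<n. \end{align*} There is an isomorphism of $R$-algebras $\mathcal E^{(W,S)}(A,\rho_\phi,\hat e)\cong\mathcal E^B_n$ that sends $g_i\mapsto g_i$, $e_i\mapsto e_i$, $f_i\mapsto f_i$ for all $i$. -/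

import Mathlib

/-! # Marin rings, Juyumaya maps and the type `B` braids and ties algebra -/

noncomputable section

namespace BraidsTies

universe u v w x y

/-! ## The geometric representation of a Coxeter group and its root system -/

section Geometric

variable {B : Type u} (M : CoxeterMatrix B)

/-- The Tits form of a Coxeter matrix on the real vector space with basis `(α_s)`, namely
`⟨α_s, α_t⟩ = -cos (π / m(s,t))`. An infinite bond is encoded by `M s t = 0`, and then the
convention `π / 0 = 0` gives the usual value `-1`. -/
def titsForm : (B →₀ ℝ) →ₗ[ℝ] (B →₀ ℝ) →ₗ[ℝ] ℝ :=
  Finsupp.linearCombination ℝ fun s : B =>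
    Finsupp.linearCombination ℝ fun t : B => -Real.cos (Real.pi / (M s t : ℝ))

/-- The simple root attached to a generator. -/
def simpleRoot (s : B) : B →₀ ℝ := Finsupp.single s 1

theorem titsForm_simpleRoot (s t : B) :
    titsForm M (simpleRoot s) (simpleRoot t) = -Real.cos (Real.pi / (M s t : ℝ)) := by
  simp [titsForm, simpleRoot]

theorem titsForm_comm (v v' : B →₀ ℝ) : titsForm M v v' = titsForm M v' v := by
  have h : titsForm M = (titsForm M).flip := by
    ext s t
    have h1 := titsForm_simpleRoot M s t
    have h2 := titsForm_simpleRoot M t s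
    rw [M.symmetric t s] at h2
    simpa [simpleRoot] using h1.trans h2.symm
  exact congrArg (fun f : (B →₀ ℝ) →ₗ[ℝ] (B →₀ ℝ) →ₗ[ℝ] ℝ => f v v') h

/-- The reflection `σ_α` in a unit vector `α`. -/
def reflect (α v : B →₀ ℝ) : B →₀ ℝ := v - (2 * titsForm M α v) • α

theorem two_smul_titsForm_self (s : B) :
    ((2 : ℝ) • titsForm M (simpleRoot s)) (simpleRoot s) = 2 := by
  simp [titsForm_simpleRoot]

/-- The reflection in a simple root, as a linear automorphism. -/
def simpleReflection (s : B) : (B →₀ ℝ) ≃ₗ[ℝ] (B →₀ ℝ) :=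
  Module.reflection (two_smul_titsForm_self M s)

theorem simpleReflection_apply (s : B) (v : B →₀ ℝ) :
    simpleReflection M s v = reflect M (simpleRoot s) v := by
  simp [simpleReflection, reflect, Module.reflection_apply]

open Polynomial.Chebyshev in
theorem simpleReflection_isLiftable : M.IsLiftable (simpleReflection M) := by
  intro s t
  rcases eq_or_ne s t with rfl | hst
  · have h : simpleReflection M s * simpleReflection M s = 1 := by
      ext1 v
      exact Module.involutive_reflection (two_smul_titsForm_self M s) v
    rw [h, one_pow]
  ext1 v
  rcases Nat.eq_zero_or_pos (M s t) with h0 | hpos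
  · rw [h0, pow_zero]
  have hne1 : M s t ≠ 1 := M.off_diagonal s t hst
  set c : ℝ := Real.cos (Real.pi / (M s t : ℝ)) with hc
  have h1 : ((2 : ℝ) • titsForm M (simpleRoot s)) (simpleRoot t) = -2 * c := by
    simp [titsForm_simpleRoot, hc]
  have h2 : ((2 : ℝ) • titsForm M (simpleRoot t)) (simpleRoot s) = -2 * c := by
    simp [titsForm_simpleRoot, hc, M.symmetric t s]
  have key := Module.reflection_mul_reflection_pow_apply (two_smul_titsForm_self M s)
    (two_smul_titsForm_self M t) (M s t) v
  change ((Module.reflection (two_smul_titsForm_self M s) *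
    Module.reflection (two_smul_titsForm_self M t)) ^ (M s t)) v = v
  rw [key, h1, h2]
  clear key
  rcases eq_or_ne (M s t) 2 with hm2 | hm2
  · have hc0 : c = 0 := by rw [hc, hm2]; simp
    rw [hm2, hc0]
    norm_num
    abel
  have hm3 : 3 ≤ M s t := by omega
  have hm3' : (3 : ℝ) ≤ (M s t : ℝ) := by exact_mod_cast hm3
  set θ : ℝ := 2 * Real.pi / (M s t : ℝ) with hθ
  have ht : (-2 * c * (-2 * c) - 2 : ℝ) = 2 * Real.cos θ := by
    have : θ = 2 * (Real.pi / (M s t : ℝ)) := by rw [hθ]; ring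
    rw [this, Real.cos_two_mul, ← hc]; ring
  have hsin : Real.sin θ ≠ 0 := by
    apply ne_of_gt
    apply Real.sin_pos_of_pos_of_lt_pi
    · have := Real.pi_pos
      positivity
    · rw [hθ, div_lt_iff₀ (by linarith)]
      nlinarith [Real.pi_pos]
  rw [ht]
  have hS : ∀ k : ℤ, (S ℝ k).eval (2 * Real.cos θ) = Real.sin ((k + 1) * θ) / Real.sin θ := by
    intro k
    rw [eq_div_iff hsin]
    exact S_two_mul_real_cos θ k
  have hmθ : (M s t : ℝ) * θ = 2 * Real.pi := by
    rw [hθ]; field_simp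
  rcases Nat.even_or_odd' (M s t) with ⟨k, hk | hk⟩
  · have hkθ : (k : ℝ) * θ = Real.pi := by
      rw [hk] at hmθ; push_cast at hmθ; linarith
    have e1 : (((M s t : ℕ) : ℤ) - 2) / 2 = (k : ℤ) - 1 := by omega
    have e2 : (((M s t : ℕ) : ℤ) - 1) / 2 = (k : ℤ) - 1 := by omega
    have hz : (S ℝ ((k : ℤ) - 1)).eval (2 * Real.cos θ) = 0 := by
      rw [hS]; push_cast; rw [sub_add_cancel, hkθ]; simp
    rw [e1, e2, hz]
    simp
  · have e1 : (((M s t : ℕ) : ℤ) - 3) / 2 = (k : ℤ) - 1 := by omega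
    have e2 : (((M s t : ℕ) : ℤ) - 1) / 2 = (k : ℤ) := by omega
    have e3 : (((M s t : ℕ) : ℤ) - 2) / 2 = (k : ℤ) - 1 := by omega
    have e4 : ((M s t : ℕ) : ℤ) / 2 = (k : ℤ) := by omega
    have hz : (S ℝ (k : ℤ)).eval (2 * Real.cos θ) +
        (S ℝ ((k : ℤ) - 1)).eval (2 * Real.cos θ) = 0 := by
      rw [hS, hS]
      push_cast
      have : ((k : ℝ) + 1) * θ = 2 * Real.pi - (k : ℝ) * θ := by
        rw [hk] at hmθ; push_cast at hmθ; linarith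
      rw [sub_add_cancel, this, Real.sin_two_pi_sub]
      ring
    rw [e1, e2, e3, e4, hz]
    simp

variable {M} {W : Type v} [Group W] (cs : CoxeterSystem M W)

/-- The standard geometric representation of a Coxeter system. -/
def geomRep : W →* ((B →₀ ℝ) ≃ₗ[ℝ] (B →₀ ℝ)) :=
  cs.lift ⟨simpleReflection M, simpleReflection_isLiftable M⟩

theorem geomRep_simple (s : B) : geomRep cs (cs.simple s) = simpleReflection M s :=
  cs.lift_apply_simple (simpleReflection_isLiftable M) s

theorem titsForm_geomRep (g : W) (v v' : B →₀ ℝ) :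
    titsForm M (geomRep cs g v) (geomRep cs g v') = titsForm M v v' := by
  induction g using cs.simple_induction_left generalizing v v' with
  | one => simp
  | mul_simple_left g s ih =>
    rw [map_mul, LinearEquiv.mul_apply, LinearEquiv.mul_apply, geomRep_simple,
      simpleReflection_apply, simpleReflection_apply, ← ih v v']
    have h := titsForm_simpleRoot M s s
    have hc := titsForm_comm M (geomRep cs g v) (simpleRoot s)
    simp only [reflect, map_sub, map_smul, LinearMap.sub_apply, LinearMap.smul_apply, smul_eq_mul,
      h, hc, M.diagonal, Nat.cast_one, div_one, Real.cos_pi]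
    ring

theorem geomRep_reflect (g : W) (α v : B →₀ ℝ) :
    geomRep cs g (reflect M α v) = reflect M (geomRep cs g α) (geomRep cs g v) := by
  simp [reflect, titsForm_geomRep]

/-- The root system `Φ` of a Coxeter system: the orbit of the simple roots. -/
def roots : Set (B →₀ ℝ) := {α | ∃ (g : W) (s : B), geomRep cs g (simpleRoot s) = α}

theorem simpleRoot_mem_roots (s : B) : simpleRoot s ∈ roots cs := ⟨1, s, by simp⟩

theorem geomRep_mem_roots (g : W) {α : B →₀ ℝ} (h : α ∈ roots cs) :
    geomRep cs g α ∈ roots cs := by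
  obtain ⟨g', s, rfl⟩ := h
  exact ⟨g * g', s, by simp⟩

theorem reflect_mem_roots {α β : B →₀ ℝ} (hα : α ∈ roots cs) (hβ : β ∈ roots cs) :
    reflect M α β ∈ roots cs := by
  obtain ⟨g, s, rfl⟩ := hα
  have h : reflect M (geomRep cs g (simpleRoot s)) β =
      geomRep cs (g * cs.simple s * g⁻¹) β := by
    have h1 : β = geomRep cs g (geomRep cs g⁻¹ β) := by
      rw [← LinearEquiv.mul_apply, ← map_mul]; simp
    conv_lhs => rw [h1, ← geomRep_reflect, ← simpleReflection_apply, ← geomRep_simple cs]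
    simp [LinearEquiv.mul_apply]
  rw [h]
  exact geomRep_mem_roots cs _ hβ

/-! ## The monoid of root subsystems -/

/-- A root subsystem of `Φ`: a set of roots that is stable under its own reflections. -/
@[ext]
structure RootSubsystem where
  carrier : Set (B →₀ ℝ)
  subset_roots : carrier ⊆ roots cs
  reflect_mem : ∀ α ∈ carrier, ∀ β ∈ carrier, reflect M α β ∈ carrier

namespace RootSubsystem

variable {cs}

/-- The root subsystem generated by a set of roots. (Vectors of `X` that are not roots would be
ignored; the definition is used only for `X ⊆ Φ`.) -/
def generated (cs : CoxeterSystem M W) (X : Set (B →₀ ℝ)) : RootSubsystem cs where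
  carrier := {α | α ∈ roots cs ∧ ∀ Ψ : RootSubsystem cs, X ∩ roots cs ⊆ Ψ.carrier → α ∈ Ψ.carrier}
  subset_roots := fun _ h => h.1
  reflect_mem := fun α hα β hβ => ⟨reflect_mem_roots cs hα.1 hβ.1, fun Ψ hΨ =>
    Ψ.reflect_mem α (hα.2 Ψ hΨ) β (hβ.2 Ψ hΨ)⟩

theorem generated_subset_iff {X : Set (B →₀ ℝ)} (hX : X ⊆ roots cs) (Ψ : RootSubsystem cs) :
    (generated cs X).carrier ⊆ Ψ.carrier ↔ X ⊆ Ψ.carrier :=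
  ⟨fun h _ hα => h ⟨hX hα, fun _ hΨ' => hΨ' ⟨hα, hX hα⟩⟩,
    fun h _ hα => hα.2 Ψ (Set.inter_subset_left.trans h)⟩

/-- The product of two root subsystems is the root subsystem that they generate. -/
instance : Mul (RootSubsystem cs) := ⟨fun Ψ Ψ' => generated cs (Ψ.carrier ∪ Ψ'.carrier)⟩

/-- The empty root subsystem is the unit. -/
instance : One (RootSubsystem cs) :=
  ⟨⟨∅, Set.empty_subset _, fun _ h => absurd h (Set.notMem_empty _)⟩⟩

theorem mul_subset_iff (Ψ Ψ' Θ : RootSubsystem cs) :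
    (Ψ * Ψ').carrier ⊆ Θ.carrier ↔ Ψ.carrier ⊆ Θ.carrier ∧ Ψ'.carrier ⊆ Θ.carrier :=
  (generated_subset_iff (Set.union_subset Ψ.subset_roots Ψ'.subset_roots) Θ).trans
    Set.union_subset_iff

theorem eq_of_forall_subset_iff {Ψ Ψ' : RootSubsystem cs}
    (h : ∀ Θ : RootSubsystem cs, Ψ.carrier ⊆ Θ.carrier ↔ Ψ'.carrier ⊆ Θ.carrier) : Ψ = Ψ' :=
  RootSubsystem.ext (Set.Subset.antisymm ((h Ψ').2 subset_rfl) ((h Ψ).1 subset_rfl))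

instance : CommMonoid (RootSubsystem cs) where
  mul_assoc Ψ Ψ' Ψ'' := eq_of_forall_subset_iff fun Θ => by simp only [mul_subset_iff, and_assoc]
  mul_comm Ψ Ψ' := eq_of_forall_subset_iff fun Θ => by simp only [mul_subset_iff, and_comm]
  one_mul Ψ := eq_of_forall_subset_iff fun Θ => by
    rw [mul_subset_iff]; exact ⟨And.right, fun h => ⟨Set.empty_subset _, h⟩⟩
  mul_one Ψ := eq_of_forall_subset_iff fun Θ => by
    rw [mul_subset_iff]; exact ⟨And.left, fun h => ⟨h, Set.empty_subset _⟩⟩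

theorem mul_self (Ψ : RootSubsystem cs) : Ψ * Ψ = Ψ :=
  eq_of_forall_subset_iff fun Θ => by simp only [mul_subset_iff, and_self]

/-- The action of the Coxeter group on root subsystems. -/
instance : SMul W (RootSubsystem cs) where
  smul g Ψ :=
    { carrier := geomRep cs g '' Ψ.carrier
      subset_roots := by
        rintro _ ⟨α, hα, rfl⟩
        exact geomRep_mem_roots cs g (Ψ.subset_roots hα)
      reflect_mem := by
        rintro _ ⟨α, hα, rfl⟩ _ ⟨β, hβ, rfl⟩
        exact ⟨_, Ψ.reflect_mem α hα β hβ, geomRep_reflect cs g α β⟩ }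

theorem smul_carrier (g : W) (Ψ : RootSubsystem cs) :
    (g • Ψ).carrier = geomRep cs g '' Ψ.carrier := rfl

instance : MulAction W (RootSubsystem cs) where
  one_smul Ψ := RootSubsystem.ext (by simp [smul_carrier])
  mul_smul g h Ψ := RootSubsystem.ext (by
    rw [smul_carrier, smul_carrier, smul_carrier, Set.image_image, map_mul]
    rfl)

theorem smul_subset_iff (g : W) (Ψ Θ : RootSubsystem cs) :
    (g • Ψ).carrier ⊆ Θ.carrier ↔ Ψ.carrier ⊆ (g⁻¹ • Θ).carrier := by
  have h : ∀ (k : W) (Ψ₁ Ψ₂ : RootSubsystem cs), Ψ₁.carrier ⊆ Ψ₂.carrier →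
      (k • Ψ₁).carrier ⊆ (k • Ψ₂).carrier := fun k _ _ => Set.image_mono
  constructor
  · intro h1
    simpa using h g⁻¹ _ _ h1
  · intro h1
    simpa using h g _ _ h1

instance : MulDistribMulAction W (RootSubsystem cs) where
  smul_mul g Ψ Ψ' := eq_of_forall_subset_iff fun Θ => by
    rw [mul_subset_iff, smul_subset_iff, smul_subset_iff, smul_subset_iff, mul_subset_iff]
  smul_one g := RootSubsystem.ext (Set.image_empty _)

end RootSubsystem

/-- The root subsystem `⟨s⟩ = {α_s, -α_s}` attached to a generator. -/
def rankOne (s : B) : RootSubsystem cs := RootSubsystem.generated cs {simpleRoot s}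

end Geometric

/-! ## Artin groups and Marin rings -/

section Marin

variable {B : Type u} {M : CoxeterMatrix B} {W : Type v} [Group W]

/-- The Artin (braid) group of a Coxeter matrix: one generator for each `s`, and for all `s, t` with
`m(s,t)` finite, the braid relation `⋯ s t = ⋯ t s` (`m(s,t)` letters on each side). For
`m(s,t) = ∞`, encoded by `0`, both words are empty. -/
def ArtinGroup (M : CoxeterMatrix B) : Type u :=
  PresentedGroup {r : FreeGroup B | ∃ s t : B,
    r = ((CoxeterSystem.alternatingWord s t (M s t)).map FreeGroup.of).prod *
      ((CoxeterSystem.alternatingWord t s (M s t)).map FreeGroup.of).prod⁻¹}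

instance (M : CoxeterMatrix B) : Group (ArtinGroup M) :=
  inferInstanceAs (Group (PresentedGroup _))

/-- The standard generators of the Artin group. -/
def ArtinGroup.gen (M : CoxeterMatrix B) (s : B) : ArtinGroup M := PresentedGroup.of s

/-- The canonical projection from the Artin group to the Coxeter group. -/
def ArtinGroup.proj (cs : CoxeterSystem M W) : ArtinGroup M →* W :=
  PresentedGroup.toGroup (f := cs.simple) (by
    rintro _ ⟨s, t, rfl⟩
    have h := cs.wordProd_braidWord_eq s t
    rw [CoxeterSystem.braidWord, CoxeterSystem.braidWord, M.symmetric t s] at h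
    simp only [CoxeterSystem.wordProd] at h
    have hl : ∀ l : List B, FreeGroup.lift cs.simple (l.map FreeGroup.of).prod =
        (l.map cs.simple).prod := by
      intro l
      rw [map_list_prod, List.map_map]
      congr 1
      exact List.map_congr_left fun a _ => by simp
    rw [map_mul, map_inv, hl, hl, h, mul_inv_cancel])

theorem ArtinGroup.proj_gen (cs : CoxeterSystem M W) (s : B) :
    ArtinGroup.proj cs (ArtinGroup.gen M s) = cs.simple s :=
  PresentedGroup.toGroup.of _

/-- A Marin datum over the ground ring `k`: an action of `W` on a commutative `k`-algebra `A`
by algebra automorphisms, and a `W`-equivariant map `a : S → Aˣ`. -/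
structure MarinDatum (k : Type w) (cs : CoxeterSystem M W) (A : Type x)
    [CommRing k] [CommRing A] [Algebra k A] where
  ρ : W →* (A ≃ₐ[k] A)
  a : B → Aˣ
  equivariant : ∀ (g : W) (s t : B), g * cs.simple s * g⁻¹ = cs.simple t →
    ρ g (a s : A) = (a t : A)

namespace MarinDatum

variable {k : Type w} {cs : CoxeterSystem M W} {A : Type x} [CommRing k] [CommRing A] [Algebra k A]
variable (D : MarinDatum k cs A)

/-- The action of the Artin group on `A` through the projection to `W`. -/
@[reducible]
def artinAction : MulSemiringAction (ArtinGroup M) A :=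
  MulSemiringAction.compHom A (D.ρ.comp (ArtinGroup.proj cs))

/-- The semidirect product `A ⋊ k[B_W]`: the free left `A`-module on the Artin group, with
`(c g) (c' g') = c (g . c') g g'`. -/
def Semidirect (_ : MarinDatum k cs A) : Type (max x u) := SkewMonoidAlgebra A (ArtinGroup M)

instance : Ring D.Semidirect :=
  letI := D.artinAction
  inferInstanceAs (Ring (SkewMonoidAlgebra A (ArtinGroup M)))

instance : Module k D.Semidirect :=
  inferInstanceAs (Module k (SkewMonoidAlgebra A (ArtinGroup M)))

/-- The element `c g` of `A ⋊ k[B_W]`. -/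
def single (g : ArtinGroup M) (c : A) : D.Semidirect := SkewMonoidAlgebra.single g c

theorem single_mul_single (g g' : ArtinGroup M) (c c' : A) :
    D.single g c * D.single g' c' =
      D.single (g * g') (c * D.ρ (ArtinGroup.proj cs g) c') := by
  let := D.artinAction
  exact SkewMonoidAlgebra.single_mul_single

theorem smul_single (r : k) (g : ArtinGroup M) (c : A) :
    r • D.single g c = D.single g (r • c) :=
  SkewMonoidAlgebra.smul_single r g c

theorem semidirect_induction {p : D.Semidirect → Prop} (z : D.Semidirect)
    (single : ∀ g c, p (D.single g c)) (add : ∀ z z', p z → p z' → p (z + z')) : p z :=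
  SkewMonoidAlgebra.induction_on' z single add

instance : Algebra k D.Semidirect :=
  Algebra.ofModule
    (fun r z z' => by
      induction z using D.semidirect_induction with
      | single g c =>
        induction z' using D.semidirect_induction with
        | single g' c' => simp only [smul_single, single_mul_single, smul_mul_assoc]
        | add z z' h h' => simp only [mul_add, smul_add, h, h']
      | add z₁ z₂ h h' => simp only [add_mul, smul_add, h, h'])
    (fun r z z' => by
      induction z using D.semidirect_induction with
      | single g c =>
        induction z' using D.semidirect_induction with
        | single g' c' => simp only [smul_single, single_mul_single, map_smul, mul_smul_comm]
        | add z z' h h' => simp only [mul_add, smul_add, h, h']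
      | add z₁ z₂ h h' => simp only [add_mul, smul_add, h, h'])

/-- The relations `g_s² = a_s + (1 - a_s) g_s`. -/
inductive HeckeRel : D.Semidirect → D.Semidirect → Prop
  | quadratic (s : B) : HeckeRel
      (D.single (ArtinGroup.gen M s) 1 * D.single (ArtinGroup.gen M s) 1)
      (D.single 1 (D.a s : A) + D.single 1 (1 - (D.a s : A)) * D.single (ArtinGroup.gen M s) 1)

/-- The Marin ring `𝓔(A, ρ, a)`: the quotient of `A ⋊ k[B_W]` by the two-sided ideal generated by
the elements `g_s² - a_s - (1 - a_s) g_s`. -/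
def MarinRing : Type (max x u) := RingQuot D.HeckeRel

instance : Ring D.MarinRing := inferInstanceAs (Ring (RingQuot D.HeckeRel))

instance : Algebra k D.MarinRing := inferInstanceAs (Algebra k (RingQuot D.HeckeRel))

/-- The quotient map from `A ⋊ k[B_W]` to the Marin ring. -/
def toMarinRing : D.Semidirect →ₐ[k] D.MarinRing := RingQuot.mkAlgHom k D.HeckeRel

/-- The element `g_s` of the Marin ring. -/
def g (s : B) : D.MarinRing := D.toMarinRing (D.single (ArtinGroup.gen M s) 1)

/-- The image in the Marin ring of an element `c` of `A`. -/
def coeff (c : A) : D.MarinRing := D.toMarinRing (D.single 1 c)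

end MarinDatum

end Marin

/-! ## Juyumaya maps -/

section Juyumaya

variable {B : Type u} {M : CoxeterMatrix B} {W : Type v} [Group W]
variable {C : Type w} {N : CoxeterMatrix C} {U : Type x} [Group U]

/-- A Juyumaya map between Coxeter systems `(W, S)` and `(U, T)`: a group homomorphism
`φ : W → U` and a `W`-equivariant map `e : S → Σ(Φ_U)` (where `W` acts on `S ⊆ W` by conjugation and
on `Σ(Φ_U)` through `φ`) such that `⟨e_s, w . e_t⟩ = ⟨e_s, (s w) . e_t⟩`. -/
@[ext]
structure JuyumayaMap (cs : CoxeterSystem M W) (ct : CoxeterSystem N U) where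
  φ : W →* U
  e : B → RootSubsystem ct
  equivariant : ∀ (g : W) (s t : B), g * cs.simple s * g⁻¹ = cs.simple t → φ g • e s = e t
  mul_eq : ∀ (s t : B) (g : W), e s * (φ g • e t) = e s * (φ (cs.simple s * g) • e t)

namespace JuyumayaMap

variable {cs : CoxeterSystem M W} {ct : CoxeterSystem N U} (J : JuyumayaMap cs ct)

/-- The monoid `Σ(Φ_U)_[e]`: the submonoid of `Σ(Φ_U)` generated by the elements `w . e_s`. -/
def tieMonoid : Submonoid (RootSubsystem ct) :=
  Submonoid.closure {Ψ | ∃ (g : W) (s : B), J.φ g • J.e s = Ψ}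

theorem smul_mem_tieMonoid (g : W) {Ψ : RootSubsystem ct} (h : Ψ ∈ J.tieMonoid) :
    J.φ g • Ψ ∈ J.tieMonoid := by
  induction h using Submonoid.closure_induction with
  | mem Ψ h =>
    obtain ⟨g', s, rfl⟩ := h
    exact Submonoid.subset_closure ⟨g * g', s, by rw [map_mul, mul_smul]⟩
  | one => rw [smul_one]; exact one_mem _
  | mul Ψ Ψ' _ _ h h' => rw [smul_mul']; exact mul_mem h h'

/-- The action `ρ_φ` of `W` on the monoid `Σ(Φ_U)_[e]`. -/
def tieAction : W →* MulAut J.tieMonoid where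
  toFun g :=
    { toFun := fun Ψ => ⟨J.φ g • Ψ.1, J.smul_mem_tieMonoid g Ψ.2⟩
      invFun := fun Ψ => ⟨J.φ g⁻¹ • Ψ.1, J.smul_mem_tieMonoid g⁻¹ Ψ.2⟩
      left_inv := fun Ψ => Subtype.ext (by simp)
      right_inv := fun Ψ => Subtype.ext (by simp)
      map_mul' := fun Ψ Ψ' => Subtype.ext (smul_mul' _ _ _) }
  map_one' := by ext1 Ψ; exact Subtype.ext (by simp)
  map_mul' g g' := by ext1 Ψ; exact Subtype.ext (by simp [mul_smul])

/-- The element `e_s`, seen in `Σ(Φ_U)_[e]`. -/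
def tie (s : B) : J.tieMonoid := ⟨J.e s, Submonoid.subset_closure ⟨1, s, by simp⟩⟩

theorem tieAction_tie (g : W) (s t : B) (h : g * cs.simple s * g⁻¹ = cs.simple t) :
    J.tieAction g (J.tie s) = J.tie t :=
  Subtype.ext (J.equivariant g s t h)

theorem tie_mul_self (s : B) : J.tie s * J.tie s = J.tie s :=
  Subtype.ext (RootSubsystem.mul_self _)

variable {R : Type y} [CommRing R]

/-- The monoid algebra `R[Σ(Φ_U)_[e]]`. -/
abbrev TieAlgebra (J : JuyumayaMap cs ct) (R : Type y) [CommRing R] : Type _ :=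
  MonoidAlgebra R J.tieMonoid

/-- The element `1 + (r - 1) e_s` of `R[Σ(Φ_U)_[e]]`, for `r` in `R`. -/
def hat (s : B) (r : R) : J.TieAlgebra R := 1 + (r - 1) • MonoidAlgebra.of R J.tieMonoid (J.tie s)

theorem hat_mul_hat (s : B) (r r' : R) (h : r * r' = 1) : J.hat s r * J.hat s r' = 1 := by
  have he : MonoidAlgebra.of R J.tieMonoid (J.tie s) * MonoidAlgebra.of R J.tieMonoid (J.tie s) =
      MonoidAlgebra.of R J.tieMonoid (J.tie s) := by
    rw [← map_mul, tie_mul_self]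
  simp only [hat, add_mul, mul_add, one_mul, mul_one, smul_mul_assoc, mul_smul_comm, he]
  have h3 : (r - 1) + ((r' - 1) + (r' - 1) * (r - 1)) = 0 := by linear_combination h
  rw [add_assoc, smul_add, smul_smul, ← add_smul, ← add_smul, h3, zero_smul, add_zero]

/-- The unit `ê_s = 1 + (u_s - 1) e_s` of `R[Σ(Φ_U)_[e]]`. -/
def hatUnit (u : B → Rˣ) (s : B) : (J.TieAlgebra R)ˣ where
  val := J.hat s (u s)
  inv := J.hat s ((u s)⁻¹ : Rˣ)
  val_inv := J.hat_mul_hat s _ _ (by simp)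
  inv_val := J.hat_mul_hat s _ _ (by simp)

/-- The Marin datum `(R[Σ(Φ_U)_[e]], ρ_φ, ê)` attached to a Juyumaya map and a `W`-equivariant map
`u : S → Rˣ`, where `W` acts trivially on `R`. -/
def marinDatum (u : B → Rˣ)
    (hu : ∀ (g : W) (s t : B), g * cs.simple s * g⁻¹ = cs.simple t → u s = u t) :
    MarinDatum R cs (J.TieAlgebra R) where
  ρ := MonoidAlgebra.domCongrAut.comp J.tieAction
  a := J.hatUnit u
  equivariant g s t h := by
    have h1 := J.tieAction_tie g s t h
    simp [hatUnit, hat, hu g s t h, MonoidAlgebra.domCongrAut, MonoidAlgebra.domCongr, h1]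

end JuyumayaMap

end Juyumaya

/-! ## Type `B` -/

section TypeB

/-- The Coxeter matrix of type `B_n`, with the generators numbered so that the bond of order `4`
joins the first two. (Indices in `Fin n` are one less than the usual labels `1, …, n`.) -/
def typeB (n : ℕ) : CoxeterMatrix (Fin n) := (CoxeterMatrix.B n).reindex Fin.revPerm

theorem typeB_apply (n : ℕ) (i j : Fin n) : typeB n i j =
    if i = j then 1
    else if (i.val = 0 ∧ j.val = 1) ∨ (i.val = 1 ∧ j.val = 0) then 4
    else if i.val + 1 = j.val ∨ j.val + 1 = i.val then 3 else 2 := by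
  have h : typeB n i j = CoxeterMatrix.B n (Fin.rev i) (Fin.rev j) := rfl
  have hi := i.isLt
  have hj := j.isLt
  rw [h]
  simp only [CoxeterMatrix.B, Matrix.of_apply, Fin.rev_inj, Fin.val_rev]
  split_ifs <;> first | rfl | (exfalso; omega)

variable {n : ℕ} {W : Type v} [Group W] {U : Type w} [Group U]
variable {cs : CoxeterSystem (typeB n) W} {ct : CoxeterSystem (CoxeterMatrix.A n) U}

/-- `J` is the Juyumaya map `W(B_n) → W(A_n)` that kills `s_1`: one has `φ(s_1) = 1`, `φ(s_i) = t_i`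
for `i ≥ 2`, and `e` takes the values `⟨t_1⟩`, `⟨t_2⟩` at the representatives `s_1`, `s_2` of the
conjugacy classes of generators. -/
structure IsBtoA (J : JuyumayaMap cs ct) : Prop where
  φ_simple : ∀ i : Fin n, J.φ (cs.simple i) = if i.val = 0 then 1 else ct.simple i
  e_representative : ∀ i : Fin n, i.val ≤ 1 → J.e i = rankOne ct i

/-- The ties `f_1 = e_1` and `f_i = s_i . f_{i-1}`. -/
def fTieAux (J : JuyumayaMap cs ct) : (i : ℕ) → i < n → J.tieMonoid
  | 0, h => J.tie ⟨0, h⟩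
  | i + 1, h => J.tieAction (cs.simple ⟨i + 1, h⟩) (fTieAux J i (Nat.lt_of_succ_lt h))

/-- The tie `f_i`. -/
def fTie (J : JuyumayaMap cs ct) (i : Fin n) : J.tieMonoid := fTieAux J i.val i.isLt

/-- The generators of the type `B` braids and ties algebra. -/
inductive Gen (n : ℕ) : Type
  | g (i : Fin n) : Gen n
  | e (i : Fin n) : Gen n
  | f (i : Fin n) : Gen n

/-- The distance `|i - j|`. -/
def gap (i j : Fin n) : ℕ := ((i.val : ℤ) - (j.val : ℤ)).natAbs

/-- `{i, j} = {1, 2}` in the usual labelling. -/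
def IsFirstPair (i j : Fin n) : Prop := (i.val = 0 ∧ j.val = 1) ∨ (i.val = 1 ∧ j.val = 0)

variable {R : Type y} [CommRing R]

/-- The generator `g_i` of the free algebra. -/
def gX (i : Fin n) : FreeAlgebra R (Gen n) := FreeAlgebra.ι R (Gen.g i)

/-- The generator `e_i` of the free algebra. -/
def eX (i : Fin n) : FreeAlgebra R (Gen n) := FreeAlgebra.ι R (Gen.e i)

/-- The generator `f_i` of the free algebra. -/
def fX (i : Fin n) : FreeAlgebra R (Gen n) := FreeAlgebra.ι R (Gen.f i)

/-- The defining relations of the type `B` braids and ties algebra with parameters `u_i`. -/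
inductive FloresRel (u : Fin n → Rˣ) : FreeAlgebra R (Gen n) → FreeAlgebra R (Gen n) → Prop
  | gg (i j : Fin n) : 1 < gap i j → FloresRel u (gX i * gX j) (gX j * gX i)
  | gggg (i j : Fin n) : i.val = 0 → j.val = 1 →
      FloresRel u (gX i * gX j * gX i * gX j) (gX j * gX i * gX j * gX i)
  | ggg (i j : Fin n) : gap i j = 1 → ¬ IsFirstPair i j →
      FloresRel u (gX i * gX j * gX i) (gX j * gX i * gX j)
  | quadratic (i : Fin n) :
      FloresRel u (gX i * gX i) (1 + ((u i : R) - 1) • (eX i * (1 - gX i)))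
  | ge (i j : Fin n) : gap i j ≠ 1 ∨ (i.val = 0 ∧ j.val = 1) →
      FloresRel u (gX i * eX j) (eX j * gX i)
  | gge (i j : Fin n) : gap i j = 1 → ¬ IsFirstPair i j →
      FloresRel u (gX j * gX i * eX j) (eX i * gX j * gX i)
  | ee (i j : Fin n) : FloresRel u (eX i * eX j) (eX j * eX i)
  | e_sq (i : Fin n) : FloresRel u (eX i * eX i) (eX i)
  | eeg_ege (i j : Fin n) : gap i j = 1 → ¬ IsFirstPair i j →
      FloresRel u (eX j * eX i * gX j) (eX i * gX j * eX i)
  | ege_gee (i j : Fin n) : gap i j = 1 → ¬ IsFirstPair i j →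
      FloresRel u (eX i * gX j * eX i) (gX j * eX i * eX j)
  | eeg_ege_first (i j : Fin n) : i.val = 0 → j.val = 1 →
      FloresRel u (eX i * eX j * gX j) (eX j * gX j * eX i)
  | ege_gee_first (i j : Fin n) : i.val = 0 → j.val = 1 →
      FloresRel u (eX j * gX j * eX i) (gX j * eX i * eX j)
  | f_first (i : Fin n) : i.val = 0 → FloresRel u (fX i) (eX i)
  | gf (i j : Fin n) : i.val = 0 ∨ (1 ≤ i.val ∧ j.val + 1 ≠ i.val ∧ j ≠ i) →
      FloresRel u (gX i * fX j) (fX j * gX i)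
  | ef (i j : Fin n) : FloresRel u (eX i * fX j) (fX j * eX i)
  | ff (i j : Fin n) : FloresRel u (fX i * fX j) (fX j * fX i)
  | gf_pred (i j : Fin n) : j.val + 1 = i.val → FloresRel u (gX i * fX j) (fX i * gX i)
  | gf_self (i j : Fin n) : j.val + 1 = i.val → FloresRel u (gX i * fX i) (fX j * gX i)
  | ef_succ (i j : Fin n) : j.val = i.val + 1 → FloresRel u (eX j * fX i) (eX j * fX j)
  | ef_ff (i j : Fin n) : j.val = i.val + 1 → FloresRel u (eX j * fX i) (fX j * fX i)

/-- Flores' type `B` braids and ties algebra `𝓔ᴮ_n` over `R`, with parameters `u_i`. -/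
def FloresAlgebra (u : Fin n → Rˣ) : Type y := RingQuot (FloresRel u)

instance (u : Fin n → Rˣ) : Ring (FloresAlgebra u) := inferInstanceAs (Ring (RingQuot _))

instance (u : Fin n → Rˣ) : Algebra R (FloresAlgebra u) :=
  inferInstanceAs (Algebra R (RingQuot _))

namespace FloresAlgebra

/-- The quotient map from the free algebra to `𝓔ᴮ_n`. -/
def mk (u : Fin n → Rˣ) : FreeAlgebra R (Gen n) →ₐ[R] FloresAlgebra u :=
  RingQuot.mkAlgHom R (FloresRel u)

/-- The generator `g_i` of `𝓔ᴮ_n`. -/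
def g (u : Fin n → Rˣ) (i : Fin n) : FloresAlgebra u := mk u (gX i)

/-- The generator `e_i` of `𝓔ᴮ_n`. -/
def e (u : Fin n → Rˣ) (i : Fin n) : FloresAlgebra u := mk u (eX i)

/-- The generator `f_i` of `𝓔ᴮ_n`. -/
def f (u : Fin n → Rˣ) (i : Fin n) : FloresAlgebra u := mk u (fX i)

end FloresAlgebra

namespace JuyumayaMap

/-- The image in the Marin ring of an element of the monoid `Σ(Φ_U)_[e]`. -/
def tieImage {B : Type u} {M : CoxeterMatrix B} {W : Type v} [Group W]
    {C : Type w} {N : CoxeterMatrix C} {U : Type x} [Group U]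
    {cs : CoxeterSystem M W} {ct : CoxeterSystem N U} (J : JuyumayaMap cs ct) (u : B → Rˣ)
    (hu : ∀ (g : W) (s t : B), g * cs.simple s * g⁻¹ = cs.simple t → u s = u t)
    (Ψ : J.tieMonoid) : (J.marinDatum u hu).MarinRing :=
  (J.marinDatum u hu).coeff (MonoidAlgebra.of R J.tieMonoid Ψ)

end JuyumayaMap

end TypeB

end BraidsTies

end

noncomputable section

namespace BraidsTies

universe u v w x y

/-!
The subsystems of a root system of type `A_n` are the equivalence relations on `{0, …, n}` and their
product is the join, so the monoid is generated by the relations `D a b` that identify one pair of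
points. These form a *tie family*: they are symmetric, commute, and `D a b * D b c = D a b * D a c`.
The map `s_1 ↦ 1`, `s_i ↦ (i-1 i)` makes the group of type `B_n` act on the points, fixing `0`.

Since `s_2, …, s_n` are conjugate, `e` is determined by `e_{s_1}` and `e_{s_2}`. That conversely the
adjacent ties `D (i-1) i` are compatible with conjugation is clear in the symmetric group for
`i ≥ 2`; for `s_1` one uses signed permutations, in which `s_1` is the sign change at the point `1`:
an element commuting with it fixes `1` up to sign, hence preserves the pair `{0, 1}`.

The Marin ring and Flores' algebra are both universal for the same data, a *braid–tie system*: braid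
generators `g_i` with the prescribed quadratic relation, together with a tie family on `{0, …, n}`
such that `g_i * D a b = D (s_i a) (s_i b) * g_i`. Here `e_i = D (i-1) i` and `f_i = D 0 i`. The
substantial point is that Flores' relations, which only mention these pairs, force the conjugates of
the `e_i` to form a whole tie family.
-/

/-! ## Tie families -/

section TieFamily

variable {α : Type*} {X : Type*} [Monoid X]

theorem noncommProd_mul_eq_self {ι : Type*} {s : Finset ι} {f : ι → X}
    (comm : (s : Set ι).Pairwise (Function.onFun Commute f)) {i : ι} (hi : i ∈ s)
    (h : f i * f i = f i) : s.noncommProd f comm * f i = s.noncommProd f comm := by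
  classical
  rw [← Finset.noncommProd_erase_mul s hi f comm, mul_assoc, h]

/-- A tie family: pairwise commuting elements `D a b`, one for each pair of points, that behave
under the join like the equivalence relations that identify just `a` with `b`. -/
structure IsTieFamily (D : α → α → X) : Prop where
  self : ∀ a, D a a = 1
  symm : ∀ a b, D a b = D b a
  commute : ∀ a b c d, Commute (D a b) (D c d)
  triangle : ∀ a b c, D a b * D b c = D a b * D a c

namespace IsTieFamily

variable {D : α → α → X} (hD : IsTieFamily D)

include hD

theorem mul_self (a b : α) : D a b * D a b = D a b := by
  rw [← hD.triangle a b b, hD.self, mul_one]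

theorem triangle_right (a b c : α) : D a b * D b c = D a c * D b c := by
  rw [hD.commute, hD.commute a c, hD.symm a b, hD.symm a c, hD.symm b c, hD.triangle c b a]

theorem mul_swap_left [DecidableEq α] (a b c d : α) :
    D a b * D (Equiv.swap a b c) d = D a b * D c d := by
  rcases eq_or_ne c a with rfl | hca
  · rw [Equiv.swap_apply_left, hD.triangle]
  rcases eq_or_ne c b with rfl | hcb
  · rw [Equiv.swap_apply_right, hD.triangle]
  · rw [Equiv.swap_apply_of_ne_of_ne hca hcb]

theorem mul_swap [DecidableEq α] (a b c d : α) :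
    D a b * D (Equiv.swap a b c) (Equiv.swap a b d) = D a b * D c d := by
  rw [hD.mul_swap_left, hD.symm c, hD.mul_swap_left, hD.symm d]

/-- The equivalence relation formed by the pairs whose tie is absorbed by `x`. -/
def absorbSetoid (x : X) : Setoid α where
  r a b := x * D a b = x
  iseqv :=
    { refl := fun a => by rw [hD.self, mul_one]
      symm := fun {a b} hab => by rwa [hD.symm]
      trans := fun {a b c} hab hbc => by
        rw [← hab, mul_assoc, ← hD.triangle, ← mul_assoc, hab, hbc] }

theorem absorbSetoid_apply {x : X} {a b : α} : hD.absorbSetoid x a b ↔ x * D a b = x := Iff.rfl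

variable [Fintype α]

open Classical in
/-- The product of the ties of all pairs of points that are related by `r`. -/
def setoidProd (r : Setoid α) : X :=
  Finset.noncommProd {p : α × α | r p.1 p.2} (fun p => D p.1 p.2)
    fun _ _ _ _ _ => hD.commute _ _ _ _

theorem commute_setoidProd {x : X} (hx : ∀ a b, Commute x (D a b)) (r : Setoid α) :
    Commute x (hD.setoidProd r) :=
  Finset.noncommProd_commute _ _ _ x fun _ _ => hx _ _

theorem commute_setoidProd_setoidProd (r s : Setoid α) :
    Commute (hD.setoidProd r) (hD.setoidProd s) :=
  hD.commute_setoidProd (fun a b => (hD.commute_setoidProd (hD.commute a b) r).symm) s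

theorem setoidProd_mul_eq_self {r : Setoid α} {a b : α} (h : r a b) :
    hD.setoidProd r * D a b = hD.setoidProd r :=
  noncommProd_mul_eq_self (f := fun p : α × α => D p.1 p.2) (i := (a, b)) _ (by simpa using h)
    (hD.mul_self a b)

theorem le_absorbSetoid_setoidProd (r : Setoid α) : r ≤ hD.absorbSetoid (hD.setoidProd r) :=
  fun _ _ h => hD.setoidProd_mul_eq_self h

theorem mul_setoidProd_eq_self {x : X} {r : Setoid α} (h : r ≤ hD.absorbSetoid x) :
    x * hD.setoidProd r = x := by
  classical
  refine Finset.noncommProd_induction _ _ _ (fun y => x * y = x)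
    (fun y z hy hz => by rw [← mul_assoc, hy, hz]) (mul_one x) fun p hp => h ?_
  simpa using hp

theorem setoidProd_eq {x : X} {r : Setoid α} (hx : ∀ a b, Commute x (D a b))
    (h : r ≤ hD.absorbSetoid x) (hr : hD.setoidProd r * x = hD.setoidProd r) :
    hD.setoidProd r = x := by
  rw [← hr, ← (hD.commute_setoidProd hx r).eq, hD.mul_setoidProd_eq_self h]

theorem setoidProd_bot : hD.setoidProd ⊥ = 1 :=
  hD.setoidProd_eq (fun _ _ => Commute.one_left _) bot_le (mul_one _)

theorem setoidProd_sup (r s : Setoid α) :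
    hD.setoidProd (r ⊔ s) = hD.setoidProd r * hD.setoidProd s := by
  refine hD.setoidProd_eq
    (fun a b => (hD.commute_setoidProd (hD.commute a b) r).symm.mul_left
      (hD.commute_setoidProd (hD.commute a b) s).symm) (sup_le ?_ ?_) ?_
  · intro a b h
    rw [hD.absorbSetoid_apply, (hD.commute_setoidProd_setoidProd r s).eq, mul_assoc,
      hD.setoidProd_mul_eq_self h]
  · intro a b h
    rw [hD.absorbSetoid_apply, mul_assoc, hD.setoidProd_mul_eq_self h]
  · have hle := hD.le_absorbSetoid_setoidProd (r ⊔ s)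
    rw [← mul_assoc, hD.mul_setoidProd_eq_self (le_sup_left.trans hle),
      hD.mul_setoidProd_eq_self (le_sup_right.trans hle)]

theorem setoidProd_eq_of_forall_le_iff {r : Setoid α} {a b : α} (h : ∀ s, r ≤ s ↔ s a b) :
    hD.setoidProd r = D a b :=
  hD.setoidProd_eq (hD.commute a b) ((h _).2 (hD.mul_self a b))
    (hD.setoidProd_mul_eq_self ((h r).1 le_rfl))

end IsTieFamily

end TieFamily

/-! ## Root subsystems in type `A` -/

section TypeA

variable {n : ℕ}

theorem typeA_apply (n : ℕ) (i j : Fin n) : CoxeterMatrix.A n i j =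
    if i = j then 1 else if j.val + 1 = i.val ∨ i.val + 1 = j.val then 3 else 2 := rfl

theorem castSucc_ne_succ (i : Fin n) : i.castSucc ≠ i.succ := Fin.castSucc_lt_succ.ne

/-- The point `a` of `{0, …, n}`, placed in the root space of type `A_n` with `0` as the origin. -/
def pointVec (a : Fin (n + 1)) : Fin n →₀ ℝ := Fin.partialSum simpleRoot a

theorem pointVec_zero : pointVec (0 : Fin (n + 1)) = 0 := Fin.partialSum_zero _

theorem pointVec_succ (i : Fin n) : pointVec i.succ = pointVec i.castSucc + simpleRoot i :=
  Fin.partialSum_succ _ i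

/-- The vector from the point `a` to the point `b`; the roots of type `A_n` are those with
`a ≠ b`. -/
def rootVec (a b : Fin (n + 1)) : Fin n →₀ ℝ := pointVec b - pointVec a

theorem rootVec_castSucc_succ (i : Fin n) : rootVec i.castSucc i.succ = simpleRoot i := by
  simp [rootVec, pointVec_succ]

/-- The embedding of the root space of type `A_n` in `ℝ^{n+1}` that sends the root from `a` to `b`
to the difference of the basis vectors of `b` and `a`. -/
def toPointSpace (n : ℕ) : (Fin n →₀ ℝ) →ₗ[ℝ] (Fin (n + 1) → ℝ) :=
  Finsupp.linearCombination ℝ fun i : Fin n => Pi.single i.succ 1 - Pi.single i.castSucc 1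

theorem toPointSpace_simpleRoot (i : Fin n) :
    toPointSpace n (simpleRoot i) = Pi.single i.succ 1 - Pi.single i.castSucc 1 := by
  simp [toPointSpace, simpleRoot]

theorem toPointSpace_pointVec (a : Fin (n + 1)) :
    toPointSpace n (pointVec a) = Pi.single a 1 - Pi.single 0 1 := by
  induction a using Fin.induction with
  | zero => simp [pointVec_zero]
  | succ i ih => rw [pointVec_succ, map_add, ih, toPointSpace_simpleRoot]; abel

theorem two_mul_titsForm_simpleRoot (i : Fin n) (v : Fin n →₀ ℝ) :
    2 * titsForm (CoxeterMatrix.A n) (simpleRoot i) v =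
      toPointSpace n v i.succ - toPointSpace n v i.castSucc := by
  have h : (2 : ℝ) • titsForm (CoxeterMatrix.A n) (simpleRoot i) =
      ((LinearMap.proj i.succ : (Fin (n + 1) → ℝ) →ₗ[ℝ] ℝ) - LinearMap.proj i.castSucc) ∘ₗ
        toPointSpace n := by
    ext j
    change 2 * titsForm (CoxeterMatrix.A n) (simpleRoot i) (simpleRoot j) =
      toPointSpace n (simpleRoot j) i.succ - toPointSpace n (simpleRoot j) i.castSucc
    simp only [titsForm_simpleRoot, toPointSpace_simpleRoot, Pi.sub_apply, Pi.single_apply,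
      typeA_apply, Fin.ext_iff, Fin.val_succ, Fin.val_castSucc]
    split_ifs <;> first | (exfalso; omega) | norm_num
  exact congrArg (fun f => f v) h

theorem two_mul_titsForm_pointVec (a : Fin (n + 1)) (v : Fin n →₀ ℝ) :
    2 * titsForm (CoxeterMatrix.A n) (pointVec a) v = toPointSpace n v a - toPointSpace n v 0 := by
  induction a using Fin.induction with
  | zero => simp [pointVec_zero]
  | succ i ih =>
    rw [pointVec_succ, map_add, LinearMap.add_apply, mul_add, ih, two_mul_titsForm_simpleRoot]
    ring

theorem two_mul_titsForm_rootVec (a b : Fin (n + 1)) (v : Fin n →₀ ℝ) :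
    2 * titsForm (CoxeterMatrix.A n) (rootVec a b) v =
      toPointSpace n v b - toPointSpace n v a := by
  rw [rootVec, map_sub, LinearMap.sub_apply, mul_sub, two_mul_titsForm_pointVec,
    two_mul_titsForm_pointVec]
  ring

theorem pointVec_swap {a b : Fin (n + 1)} (hab : a ≠ b) (c : Fin (n + 1)) :
    pointVec (Equiv.swap a b c) = pointVec c -
      ((Pi.single c 1 : Fin (n + 1) → ℝ) b - (Pi.single c 1 : Fin (n + 1) → ℝ) a) •
        rootVec a b := by
  rcases eq_or_ne c a with rfl | hca
  · simp [hab.symm, rootVec]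
  rcases eq_or_ne c b with rfl | hcb
  · simp [hab, rootVec]
  · simp [Equiv.swap_apply_of_ne_of_ne hca hcb, hca.symm, hcb.symm]

theorem reflect_rootVec {a b : Fin (n + 1)} (hab : a ≠ b) (c d : Fin (n + 1)) :
    reflect (CoxeterMatrix.A n) (rootVec a b) (rootVec c d) =
      rootVec (Equiv.swap a b c) (Equiv.swap a b d) := by
  rw [reflect, two_mul_titsForm_rootVec, rootVec.eq_def c d, rootVec.eq_def (Equiv.swap a b c),
    pointVec_swap hab, pointVec_swap hab, map_sub, toPointSpace_pointVec, toPointSpace_pointVec]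
  simp only [Pi.sub_apply]
  module

theorem reflect_rootVec_self {a b : Fin (n + 1)} (hab : a ≠ b) :
    reflect (CoxeterMatrix.A n) (rootVec a b) (rootVec a b) = rootVec b a := by
  rw [reflect_rootVec hab, Equiv.swap_apply_left, Equiv.swap_apply_right]

theorem reflect_rootVec_adjacent {a b c : Fin (n + 1)} (hab : a ≠ b) (hac : a ≠ c) (hbc : b ≠ c) :
    reflect (CoxeterMatrix.A n) (rootVec a b) (rootVec b c) = rootVec a c := by
  rw [reflect_rootVec hab, Equiv.swap_apply_right, Equiv.swap_apply_of_ne_of_ne hac.symm hbc.symm]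

theorem rootVec_injective {a b c d : Fin (n + 1)} (hab : a ≠ b) (h : rootVec a b = rootVec c d) :
    a = c ∧ b = d := by
  have hpoint : ∀ x, (Pi.single b 1 - Pi.single a 1 : Fin (n + 1) → ℝ) x =
      (Pi.single d 1 - Pi.single c 1 : Fin (n + 1) → ℝ) x := fun x => by
    have := congrFun (congrArg (toPointSpace n) h) x
    simpa only [rootVec, map_sub, toPointSpace_pointVec, sub_sub_sub_cancel_right] using this
  have ha := hpoint a
  have hb := hpoint b
  simp only [Pi.sub_apply, Pi.single_apply, if_neg hab, if_neg hab.symm, if_true] at ha hb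
  constructor
  · by_contra hac
    rw [if_neg hac] at ha
    split_ifs at ha <;> norm_num at ha
  · by_contra hbd
    rw [if_neg hbd] at hb
    split_ifs at hb <;> norm_num at hb

/-- The transposition of the points `i` and `i + 1` of `{0, …, n}`. -/
def adjSwap (i : Fin n) : Equiv.Perm (Fin (n + 1)) := Equiv.swap i.castSucc i.succ

theorem adjSwap_mul_self (i : Fin n) : adjSwap i * adjSwap i = 1 := Equiv.swap_mul_self _ _

theorem adjSwap_apply_of_ne {i : Fin n} {x : Fin (n + 1)} (h₁ : x.val ≠ i.val)
    (h₂ : x.val ≠ i.val + 1) : adjSwap i x = x :=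
  Equiv.swap_apply_of_ne_of_ne (fun h => h₁ (by simp [h])) fun h => h₂ (by simp [h])

theorem commute_adjSwap {i j : Fin n} (hij : i.val + 1 ≠ j.val) (hji : j.val + 1 ≠ i.val) :
    Commute (adjSwap i) (adjSwap j) := by
  rcases eq_or_ne i j with rfl | hne
  · exact Commute.refl _
  refine Equiv.Perm.Disjoint.commute fun x => ?_
  have hval : i.val ≠ j.val := Fin.val_ne_iff.2 hne
  by_cases hx : x.val = i.val ∨ x.val = i.val + 1
  · exact Or.inr (adjSwap_apply_of_ne (by omega) (by omega))
  · rw [not_or] at hx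
    exact Or.inl (adjSwap_apply_of_ne hx.1 hx.2)

theorem adjSwap_braid {i j : Fin n} (h : i.val + 1 = j.val) :
    adjSwap i * adjSwap j * adjSwap i = adjSwap j * adjSwap i * adjSwap j := by
  have hmid : j.castSucc = i.succ := Fin.ext h.symm
  have hij : i.castSucc ≠ j.succ := by
    rw [← Fin.val_ne_iff, Fin.val_castSucc, Fin.val_succ]
    omega
  have hj : i.succ ≠ j.succ := hmid ▸ castSucc_ne_succ j
  rw [adjSwap, adjSwap, hmid, Equiv.swap_mul_swap_mul_swap (castSucc_ne_succ i) hij,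
    Equiv.swap_comm i.succ j.succ, Equiv.swap_comm i.castSucc i.succ,
    Equiv.swap_mul_swap_mul_swap hj.symm hij.symm, Equiv.swap_comm]

theorem mul_pow_two_of_commute {G : Type*} [Group G] {a b : G} (ha : a * a = 1) (hb : b * b = 1)
    (h : Commute a b) : (a * b) ^ 2 = 1 := by
  rw [h.mul_pow, pow_two, pow_two, ha, hb, one_mul]

theorem mul_pow_three_of_braid {G : Type*} [Group G] {a b : G} (ha : a * a = 1) (hb : b * b = 1)
    (h : a * b * a = b * a * b) : (a * b) ^ 3 = 1 := by
  calc (a * b) ^ 3 = (a * b * a) * (b * a * b) := by simp only [pow_succ, pow_zero]; group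
    _ = a * b * (a * a) * b * a := by rw [← h]; group
    _ = 1 := by rw [ha, mul_one, mul_assoc a, hb, mul_one, ha]

theorem isLiftable_adjSwap : (CoxeterMatrix.A n).IsLiftable adjSwap := by
  intro i j
  rw [typeA_apply]
  split_ifs with heq hadj
  · rw [heq, adjSwap_mul_self, pow_one]
  · refine mul_pow_three_of_braid (adjSwap_mul_self i) (adjSwap_mul_self j) ?_
    exact hadj.elim (fun h => (adjSwap_braid h).symm) adjSwap_braid
  · rw [not_or] at hadj
    exact mul_pow_two_of_commute (adjSwap_mul_self i) (adjSwap_mul_self j)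
      (commute_adjSwap hadj.2 hadj.1)

variable {U : Type w} [Group U] (ct : CoxeterSystem (CoxeterMatrix.A n) U)

/-- The action of a Coxeter group of type `A_n` on `{0, …, n}` by permutations. -/
def permHom : U →* Equiv.Perm (Fin (n + 1)) := ct.lift ⟨adjSwap, isLiftable_adjSwap⟩

theorem permHom_simple (i : Fin n) : permHom ct (ct.simple i) = adjSwap i :=
  ct.lift_apply_simple isLiftable_adjSwap i

theorem geomRep_rootVec (g : U) (a b : Fin (n + 1)) :
    geomRep ct g (rootVec a b) = rootVec (permHom ct g a) (permHom ct g b) := by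
  induction g using ct.simple_induction_left generalizing a b with
  | one => simp
  | mul_simple_left g i ih =>
    rw [map_mul, LinearEquiv.mul_apply, ih, geomRep_simple, simpleReflection_apply,
      ← rootVec_castSucc_succ, reflect_rootVec (castSucc_ne_succ i), map_mul, permHom_simple]
    rfl

theorem rootVec_mem_roots_of_lt {a b : Fin (n + 1)} (hab : a < b) : rootVec a b ∈ roots ct := by
  induction b using Fin.induction with
  | zero => exact absurd hab (Fin.not_lt_zero a)
  | succ i ih =>
    have hsimple : rootVec i.castSucc i.succ ∈ roots ct := by
      rw [rootVec_castSucc_succ]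
      exact simpleRoot_mem_roots ct i
    rcases eq_or_ne a i.castSucc with rfl | hne
    · exact hsimple
    · have hroot := ih (lt_of_le_of_ne (Fin.le_castSucc_iff.2 hab) hne)
      have hreflect := reflect_mem_roots ct hsimple hroot
      rwa [reflect_rootVec (castSucc_ne_succ i), Equiv.swap_apply_left,
        Equiv.swap_apply_of_ne_of_ne hne hab.ne] at hreflect

theorem rootVec_mem_roots {a b : Fin (n + 1)} (hab : a ≠ b) : rootVec a b ∈ roots ct := by
  rcases lt_or_gt_of_ne hab with hlt | hgt
  · exact rootVec_mem_roots_of_lt ct hlt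
  · have hroot := rootVec_mem_roots_of_lt ct hgt
    rw [← reflect_rootVec_self hab.symm]
    exact reflect_mem_roots ct hroot hroot

theorem mem_roots_iff (α : Fin n →₀ ℝ) :
    α ∈ roots ct ↔ ∃ a b : Fin (n + 1), a ≠ b ∧ rootVec a b = α := by
  constructor
  · rintro ⟨g, i, rfl⟩
    exact ⟨_, _, (permHom ct g).injective.ne (castSucc_ne_succ i),
      by rw [← rootVec_castSucc_succ, geomRep_rootVec]⟩
  · rintro ⟨a, b, hab, rfl⟩
    exact rootVec_mem_roots ct hab

theorem rel_swap_apply {α : Type*} [DecidableEq α] (r : Setoid α) {a b : α} (h : r a b) (x : α) :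
    r (Equiv.swap a b x) x := by
  rcases eq_or_ne x a with rfl | hxa
  · rw [Equiv.swap_apply_left]
    exact r.symm h
  rcases eq_or_ne x b with rfl | hxb
  · rw [Equiv.swap_apply_right]
    exact h
  · rw [Equiv.swap_apply_of_ne_of_ne hxa hxb]

namespace RootSubsystem

/-- The root subsystem of type `A_n` attached to an equivalence relation on `{0, …, n}`. -/
def ofSetoid (r : Setoid (Fin (n + 1))) : RootSubsystem ct where
  carrier := {α | ∃ a b, a ≠ b ∧ r a b ∧ rootVec a b = α}
  subset_roots := by
    rintro _ ⟨a, b, hab, -, rfl⟩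
    exact rootVec_mem_roots ct hab
  reflect_mem := by
    rintro _ ⟨a, b, hab, h, rfl⟩ _ ⟨c, d, hcd, h', rfl⟩
    exact ⟨_, _, (Equiv.swap a b).injective.ne hcd,
      r.trans (rel_swap_apply r h c) (r.trans h' (r.symm (rel_swap_apply r h d))),
      (reflect_rootVec hab c d).symm⟩

variable {ct}

/-- The equivalence relation on `{0, …, n}` that relates two points when they are equal or joined by
a root of `Θ`. -/
def toSetoid (Θ : RootSubsystem ct) : Setoid (Fin (n + 1)) where
  r a b := a = b ∨ rootVec a b ∈ Θ.carrier
  iseqv :=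
    { refl := fun a => Or.inl rfl
      symm := by
        rintro a b (rfl | h)
        · exact Or.inl rfl
        rcases eq_or_ne a b with rfl | hab
        · exact Or.inl rfl
        · exact Or.inr (reflect_rootVec_self hab ▸ Θ.reflect_mem _ h _ h)
      trans := by
        rintro a b c (rfl | h) (rfl | h')
        · exact Or.inl rfl
        · exact Or.inr h'
        · exact Or.inr h
        rcases eq_or_ne a b with rfl | hab
        · exact Or.inr h'
        rcases eq_or_ne b c with rfl | hbc
        · exact Or.inr h
        rcases eq_or_ne a c with rfl | hac
        · exact Or.inl rfl
        · exact Or.inr (reflect_rootVec_adjacent hab hac hbc ▸ Θ.reflect_mem _ h _ h') }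

theorem toSetoid_apply {Θ : RootSubsystem ct} {a b : Fin (n + 1)} :
    Θ.toSetoid a b ↔ a = b ∨ rootVec a b ∈ Θ.carrier := Iff.rfl

theorem toSetoid_apply_of_ne {Θ : RootSubsystem ct} {a b : Fin (n + 1)} (hab : a ≠ b) :
    Θ.toSetoid a b ↔ rootVec a b ∈ Θ.carrier := or_iff_right hab

theorem toSetoid_le_toSetoid_iff {Ψ Θ : RootSubsystem ct} :
    Ψ.toSetoid ≤ Θ.toSetoid ↔ Ψ.carrier ⊆ Θ.carrier := by
  constructor
  · intro h α hα
    obtain ⟨a, b, hab, rfl⟩ := (mem_roots_iff ct α).1 (Ψ.subset_roots hα)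
    exact (toSetoid_apply_of_ne hab).1 (h (Or.inr hα))
  · rintro h a b (rfl | hroot)
    · exact Or.inl rfl
    · exact Or.inr (h hroot)

theorem toSetoid_ofSetoid (r : Setoid (Fin (n + 1))) : (ofSetoid ct r).toSetoid = r := by
  ext a b
  constructor
  · rintro (rfl | ⟨c, d, hcd, h, h'⟩)
    · exact r.refl a
    · obtain ⟨rfl, rfl⟩ := rootVec_injective hcd h'
      exact h
  · intro h
    rcases eq_or_ne a b with rfl | hab
    · exact Or.inl rfl
    · exact Or.inr ⟨a, b, hab, h, rfl⟩

theorem toSetoid_one : (1 : RootSubsystem ct).toSetoid = ⊥ := by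
  ext a b
  exact or_iff_left (Set.notMem_empty _)

theorem toSetoid_mul (Ψ Θ : RootSubsystem ct) :
    (Ψ * Θ).toSetoid = Ψ.toSetoid ⊔ Θ.toSetoid :=
  eq_of_forall_ge_iff fun r => by
    rw [← toSetoid_ofSetoid (ct := ct) r]
    simp only [sup_le_iff, toSetoid_le_toSetoid_iff, mul_subset_iff]

theorem toSetoid_smul_apply (g : U) (Θ : RootSubsystem ct) (a b : Fin (n + 1)) :
    (g • Θ).toSetoid (permHom ct g a) (permHom ct g b) ↔ Θ.toSetoid a b := by
  simp only [toSetoid_apply, smul_carrier, ← geomRep_rootVec, (permHom ct g).injective.eq_iff,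
    (geomRep ct g).injective.mem_set_image]

end RootSubsystem

open RootSubsystem

/-- The root subsystem generated by the root that joins `a` and `b`; it is trivial when `a = b`. -/
def pairSubsystem (a b : Fin (n + 1)) : RootSubsystem ct :=
  generated ct {α | a ≠ b ∧ rootVec a b = α}

variable {ct}

theorem pairSubsystem_subset_iff {a b : Fin (n + 1)} {Θ : RootSubsystem ct} :
    (pairSubsystem ct a b).carrier ⊆ Θ.carrier ↔ Θ.toSetoid a b := by
  rw [pairSubsystem, generated_subset_iff]
  · rcases eq_or_ne a b with rfl | hab
    · simp
    · simp [toSetoid_apply_of_ne, hab]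
  · rintro _ ⟨hab, rfl⟩
    exact rootVec_mem_roots ct hab

theorem toSetoid_pairSubsystem_le_iff {a b : Fin (n + 1)} (r : Setoid (Fin (n + 1))) :
    (pairSubsystem ct a b).toSetoid ≤ r ↔ r a b := by
  rw [← toSetoid_ofSetoid (ct := ct) r, toSetoid_le_toSetoid_iff, pairSubsystem_subset_iff]

theorem isTieFamily_pairSubsystem : IsTieFamily (pairSubsystem ct) where
  self a := eq_of_forall_subset_iff fun Θ =>
    iff_of_true (pairSubsystem_subset_iff.2 (Θ.toSetoid.refl a)) (Set.empty_subset _)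
  symm a b := eq_of_forall_subset_iff fun Θ => by
    rw [pairSubsystem_subset_iff, pairSubsystem_subset_iff, Setoid.comm']
  commute _ _ _ _ := Commute.all _ _
  triangle a b c := eq_of_forall_subset_iff fun Θ => by
    simp only [mul_subset_iff, pairSubsystem_subset_iff]
    exact and_congr_right fun h => ⟨Θ.toSetoid.trans h, Θ.toSetoid.trans (Θ.toSetoid.symm h)⟩

variable (ct) in
theorem rankOne_eq_pairSubsystem (i : Fin n) :
    rankOne ct i = pairSubsystem ct i.castSucc i.succ := by
  rw [rankOne, pairSubsystem]
  congr 1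
  ext α
  simp [castSucc_ne_succ, rootVec_castSucc_succ, eq_comm]

theorem smul_pairSubsystem (g : U) (a b : Fin (n + 1)) :
    g • pairSubsystem ct a b = pairSubsystem ct (permHom ct g a) (permHom ct g b) :=
  eq_of_forall_subset_iff fun Θ => by
    rw [smul_subset_iff, pairSubsystem_subset_iff, pairSubsystem_subset_iff,
      ← toSetoid_smul_apply g, smul_inv_smul]

/-- The homomorphism from the monoid of root subsystems of type `A_n` that extends a tie family on
`{0, …, n}`. -/
def IsTieFamily.rootSubsystemHom {X : Type*} [Monoid X] {D : Fin (n + 1) → Fin (n + 1) → X}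
    (hD : IsTieFamily D) (ct : CoxeterSystem (CoxeterMatrix.A n) U) : RootSubsystem ct →* X where
  toFun Θ := hD.setoidProd Θ.toSetoid
  map_one' := by rw [toSetoid_one, hD.setoidProd_bot]
  map_mul' Ψ Θ := by rw [toSetoid_mul, hD.setoidProd_sup]

theorem IsTieFamily.rootSubsystemHom_pairSubsystem {X : Type*} [Monoid X]
    {D : Fin (n + 1) → Fin (n + 1) → X} (hD : IsTieFamily D) (a b : Fin (n + 1)) :
    hD.rootSubsystemHom ct (pairSubsystem ct a b) = D a b :=
  hD.setoidProd_eq_of_forall_le_iff toSetoid_pairSubsystem_le_iff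

end TypeA

/-! ## The Juyumaya map from type `B` to type `A` -/

section BtoA

section Liftable

variable {n : ℕ} {α : Type*}

/-- The family `f` with the value at the first index replaced by `a`. -/
def replaceFirst (a : α) (f : Fin n → α) (i : Fin n) : α := if i.val = 0 then a else f i

theorem replaceFirst_of_eq_zero (a : α) (f : Fin n → α) {i : Fin n} (hi : i.val = 0) :
    replaceFirst a f i = a := if_pos hi

theorem replaceFirst_of_ne_zero (a : α) (f : Fin n → α) {i : Fin n} (hi : i.val ≠ 0) :
    replaceFirst a f i = f i := if_neg hi

variable {G : Type*} [Group G]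

theorem mul_pow_four_of_commute_conj {a b : G} (ha : a * a = 1) (hb : b * b = 1)
    (h : Commute a (b * a * b)) : (a * b) ^ 4 = 1 := by
  have hconj : (b * a * b) * (b * a * b) = 1 := by
    calc (b * a * b) * (b * a * b) = b * (a * (b * b) * a) * b := by group
      _ = 1 := by rw [hb, mul_one, ha, mul_one, hb]
  calc (a * b) ^ 4 = (a * (b * a * b)) ^ 2 := by simp only [pow_succ, pow_zero]; group
    _ = 1 := mul_pow_two_of_commute ha hconj h

theorem mul_pow_eq_one_comm {a b : G} (ha : a * a = 1) (hb : b * b = 1) {k : ℕ}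
    (h : (a * b) ^ k = 1) : (b * a) ^ k = 1 := by
  rw [eq_inv_of_mul_eq_one_left ha, eq_inv_of_mul_eq_one_left hb, ← mul_inv_rev, inv_pow, h,
    inv_one]

theorem conj_eq_of_mul_pow_three {a b : G} (ha : a * a = 1) (hb : b * b = 1)
    (h : (a * b) ^ 3 = 1) : a * b * a * (a * b)⁻¹ = b := by
  have hbraid : (a * b * a) * (b * a * b) = 1 := by
    rw [← h]
    simp only [pow_succ, pow_zero]
    group
  rw [eq_inv_of_mul_eq_one_left hbraid, ← mul_inv_rev, ← eq_inv_of_mul_eq_one_left]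
  calc b * (a * b * (b * a * b)) = b * (a * (b * b) * a) * b := by group
    _ = 1 := by rw [hb, mul_one, ha, mul_one, hb]

theorem typeB_eq_typeA {i j : Fin n} (hi : i.val ≠ 0) (hj : j.val ≠ 0) :
    typeB n i j = CoxeterMatrix.A n i j := by
  rw [typeB_apply, typeA_apply]
  split_ifs <;> first | rfl | (exfalso; omega)

theorem replaceFirst_mul_self {a : G} {f : Fin n → G} (ha : a * a = 1) (hf : ∀ i, f i * f i = 1)
    (i : Fin n) : replaceFirst a f i * replaceFirst a f i = 1 := by
  rw [replaceFirst]
  split_ifs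
  exacts [ha, hf i]

/-- Deleting the end node that carries the bond of order `4` from the diagram of type `B_n` leaves a
diagram of type `A`, so only the relations that involve `a` need to be checked. -/
theorem isLiftable_replaceFirst {a : G} {f : Fin n → G} (hf : (CoxeterMatrix.A n).IsLiftable f)
    (ha : a * a = 1) (hone : ∀ j : Fin n, j.val = 1 → Commute a (f j * a * f j))
    (htwo : ∀ j : Fin n, 2 ≤ j.val → Commute a (f j)) :
    (typeB n).IsLiftable (replaceFirst a f) := by
  have hf_sq (i) : f i * f i = 1 := by simpa using hf i i
  have hsq := replaceFirst_mul_self ha hf_sq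
  have hfirst (i j : Fin n) (hi : i.val = 0) (hj : j.val ≠ 0) : (a * f j) ^ typeB n i j = 1 := by
    have hne : i ≠ j := fun h => hj (h ▸ hi)
    rcases eq_or_ne j.val 1 with hj1 | hj1
    · rw [typeB_apply, if_neg hne, if_pos (Or.inl ⟨hi, hj1⟩)]
      exact mul_pow_four_of_commute_conj ha (hf_sq j) (hone j hj1)
    · rw [typeB_apply, if_neg hne, if_neg (by omega), if_neg (by omega)]
      exact mul_pow_two_of_commute ha (hf_sq j) (htwo j (by omega))
  intro i j
  rcases eq_or_ne i j with rfl | hij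
  · rw [(typeB n).diagonal, pow_one, hsq]
  by_cases hi : i.val = 0
  · have hj : j.val ≠ 0 := fun hj => hij (Fin.ext (hi.trans hj.symm))
    rw [replaceFirst_of_eq_zero a f hi, replaceFirst_of_ne_zero a f hj]
    exact hfirst i j hi hj
  by_cases hj : j.val = 0
  · rw [replaceFirst_of_ne_zero a f hi, replaceFirst_of_eq_zero a f hj, (typeB n).symmetric]
    exact mul_pow_eq_one_comm ha (hf_sq i) (hfirst j i hj hi)
  · rw [replaceFirst_of_ne_zero a f hi, replaceFirst_of_ne_zero a f hj, typeB_eq_typeA hi hj]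
    exact hf i j

end Liftable

section Conjugation

theorem IsTieFamily.eq_of_swap_eq {α X : Type*} [DecidableEq α] [Monoid X] {D : α → α → X}
    (hD : IsTieFamily D) {a b c d : α} (hcd : c ≠ d) (h : Equiv.swap a b = Equiv.swap c d) :
    D a b = D c d := by
  have hc : Equiv.swap a b c = d := by rw [h, Equiv.swap_apply_left]
  rw [Equiv.swap_apply_def] at hc
  split_ifs at hc with hca hcb
  · rw [hca, hc]
  · rw [hcb, hc, hD.symm]
  · exact absurd hc hcd

variable {n : ℕ} {U : Type w} [Group U] (ct : CoxeterSystem (CoxeterMatrix.A n) U)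

theorem smul_rankOne_of_conj {g : U} {i j : Fin n} (h : g * ct.simple i * g⁻¹ = ct.simple j) :
    g • rankOne ct i = rankOne ct j := by
  rw [rankOne_eq_pairSubsystem, rankOne_eq_pairSubsystem, smul_pairSubsystem]
  refine isTieFamily_pairSubsystem.eq_of_swap_eq (castSucc_ne_succ j) ?_
  have hperm := congrArg (permHom ct) h
  rwa [map_mul, map_mul, map_inv, permHom_simple, permHom_simple, adjSwap,
    ← Equiv.swap_apply_apply, adjSwap] at hperm

theorem simple_ne_one (i : Fin n) : ct.simple i ≠ 1 := by
  intro h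
  have hperm := Equiv.congr_fun (congrArg (permHom ct) h) i.castSucc
  rw [permHom_simple, adjSwap, Equiv.swap_apply_left, map_one, Equiv.Perm.one_apply] at hperm
  exact castSucc_ne_succ i hperm.symm

end Conjugation

section SignedPermutations

variable {α : Type*}

/-- The action of the permutations of the points on the signed points. -/
def signedPerm (α : Type*) : Equiv.Perm α →* Equiv.Perm (α × Bool) where
  toFun σ := Equiv.prodCongr σ (Equiv.refl Bool)
  map_one' := rfl
  map_mul' _ _ := rfl

theorem signedPerm_apply (σ : Equiv.Perm α) (p : α × Bool) :
    signedPerm α σ p = (σ p.1, p.2) := rfl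

variable [DecidableEq α]

/-- The sign change at the point `a`. -/
def signFlip (a : α) : Equiv.Perm (α × Bool) :=
  Function.Involutive.toPerm (fun p => (p.1, if p.1 = a then !p.2 else p.2)) (by
    rintro ⟨b, s⟩
    by_cases h : b = a <;> simp [h])

theorem signFlip_apply (a : α) (p : α × Bool) :
    signFlip a p = (p.1, if p.1 = a then !p.2 else p.2) := rfl

theorem signFlip_mul_self (a : α) : signFlip a * signFlip a = 1 := by
  ext1 ⟨b, s⟩
  by_cases h : b = a <;> simp [signFlip_apply, h]

theorem commute_signFlip (a b : α) : Commute (signFlip a) (signFlip b) := by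
  ext1 ⟨c, s⟩
  simp only [signFlip_apply, Equiv.Perm.mul_apply]
  split_ifs <;> rfl

theorem signedPerm_mul_signFlip (σ : Equiv.Perm α) (a : α) :
    signedPerm α σ * signFlip a = signFlip (σ a) * signedPerm α σ := by
  ext1 ⟨c, s⟩
  simp [signFlip_apply, signedPerm_apply]

theorem signFlip_injective : Function.Injective (signFlip : α → Equiv.Perm (α × Bool)) := by
  intro a b h
  by_contra hab
  have := congrArg Prod.snd (Equiv.congr_fun h (a, true))
  simp [signFlip_apply, hab] at this

end SignedPermutations

variable {n : ℕ} {W : Type v} [Group W] {U : Type w} [Group U]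
variable (cs : CoxeterSystem (typeB n) W) (ct : CoxeterSystem (CoxeterMatrix.A n) U)

/-- The homomorphism from type `B_n` to type `A_n` that kills the first generator and sends each
other generator to the one with the same index. -/
def bToAHom : W →* U :=
  cs.lift ⟨replaceFirst 1 ct.simple,
    isLiftable_replaceFirst (ct.simple_mul_simple_pow) (one_mul 1)
      (fun _ _ => Commute.one_left _) fun _ _ => Commute.one_left _⟩

theorem bToAHom_simple (i : Fin n) :
    bToAHom cs ct (cs.simple i) = replaceFirst 1 ct.simple i :=
  cs.lift_apply_simple _ i

/-- The permutations of `{0, …, n}` by which the generators of type `B_n` act through `bToAHom`. -/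
def bSwap (i : Fin n) : Equiv.Perm (Fin (n + 1)) := replaceFirst 1 adjSwap i

theorem permHom_bToAHom_simple (i : Fin n) :
    permHom ct (bToAHom cs ct (cs.simple i)) = bSwap i := by
  rw [bToAHom_simple, bSwap, replaceFirst, replaceFirst]
  split_ifs
  exacts [map_one _, permHom_simple ct i]

theorem bSwap_eq_one {i : Fin n} (hi : i.val = 0) : bSwap i = 1 :=
  replaceFirst_of_eq_zero _ _ hi

theorem bSwap_eq_adjSwap {i : Fin n} (hi : i.val ≠ 0) : bSwap i = adjSwap i :=
  replaceFirst_of_ne_zero _ _ hi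

theorem bSwap_apply_of_ne {i : Fin n} {x : Fin (n + 1)} (h₁ : x.val ≠ i.val)
    (h₂ : x.val ≠ i.val + 1) : bSwap i x = x := by
  rw [bSwap, replaceFirst]
  split_ifs
  exacts [rfl, adjSwap_apply_of_ne h₁ h₂]

theorem bSwap_zero (i : Fin n) : bSwap i 0 = 0 := by
  by_cases hi : i.val = 0
  · rw [bSwap_eq_one hi, Equiv.Perm.one_apply]
  · exact bSwap_apply_of_ne (Ne.symm hi) (Nat.succ_ne_zero _).symm

theorem permHom_bToAHom_zero (g : W) : permHom ct (bToAHom cs ct g) 0 = 0 := by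
  induction g using cs.simple_induction_left with
  | one => simp
  | mul_simple_left g i ih =>
    rw [map_mul, map_mul, Equiv.Perm.mul_apply, ih, permHom_bToAHom_simple, bSwap_zero]

theorem succ_eq_one {i : Fin n} (hi : i.val = 0) : i.succ = 1 := by
  obtain ⟨m, rfl⟩ := Nat.exists_eq_succ_of_ne_zero i.pos.ne'
  exact Fin.ext (by simp [hi])

/-- The homomorphism from type `B_n` to the signed permutations of `{0, …, n}` that sends the first
generator to the sign change at the point `1`. -/
def signedPermHom : W →* Equiv.Perm (Fin (n + 1) × Bool) :=
  cs.lift ⟨replaceFirst (signFlip 1) fun i => signedPerm _ (adjSwap i), by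
    refine isLiftable_replaceFirst (fun i j => ?_) (signFlip_mul_self 1) (fun j _ => ?_)
      fun j hj => ?_
    · rw [← map_mul, ← map_pow, isLiftable_adjSwap i j, map_one]
    · rw [signedPerm_mul_signFlip, mul_assoc, ← map_mul, adjSwap_mul_self,
        map_one (signedPerm _), mul_one]
      exact commute_signFlip _ _
    · have h1 : (1 : Fin (n + 1)) = (⟨0, j.pos⟩ : Fin n).succ := (succ_eq_one rfl).symm
      rw [Commute, SemiconjBy, signedPerm_mul_signFlip, h1,
        adjSwap_apply_of_ne (by simp; omega) (by simp; omega)]⟩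

theorem signedPermHom_simple (i : Fin n) : signedPermHom cs (cs.simple i) =
    replaceFirst (signFlip 1) (fun i => signedPerm _ (adjSwap i)) i :=
  cs.lift_apply_simple _ i

theorem signedPermHom_mul_signFlip (g : W) (a : Fin (n + 1)) :
    signedPermHom cs g * signFlip a =
      signFlip (permHom ct (bToAHom cs ct g) a) * signedPermHom cs g := by
  induction g using cs.simple_induction_left with
  | one => simp
  | mul_simple_left g i ih =>
    rw [map_mul, mul_assoc, ih, ← mul_assoc, ← mul_assoc, map_mul, map_mul,
      permHom_bToAHom_simple, Equiv.Perm.mul_apply, signedPermHom_simple, bSwap, replaceFirst,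
      replaceFirst]
    congr 1
    split_ifs
    · exact commute_signFlip _ _
    · exact signedPerm_mul_signFlip _ _

theorem permHom_bToAHom_one {g : W} {i : Fin n} (hi : i.val = 0)
    (h : g * cs.simple i * g⁻¹ = cs.simple i) : permHom ct (bToAHom cs ct g) 1 = 1 := by
  have hsigned := congrArg (signedPermHom cs) h
  rw [map_mul, map_mul, map_inv, signedPermHom_simple, replaceFirst_of_eq_zero _ _ hi,
    signedPermHom_mul_signFlip cs ct, mul_inv_cancel_right] at hsigned
  exact signFlip_injective hsigned

theorem bToAHom_smul_rankOne {g : W} {i j : Fin n} (h : g * cs.simple i * g⁻¹ = cs.simple j) :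
    bToAHom cs ct g • rankOne ct i = rankOne ct j := by
  have himage := congrArg (bToAHom cs ct) h
  rw [map_mul, map_mul, map_inv, bToAHom_simple, bToAHom_simple] at himage
  by_cases hi : i.val = 0 <;> by_cases hj : j.val = 0
  · obtain rfl : i = j := Fin.ext (hi.trans hj.symm)
    have h0 : i.castSucc = 0 := Fin.ext hi
    rw [rankOne_eq_pairSubsystem, smul_pairSubsystem, h0, succ_eq_one hi, permHom_bToAHom_zero,
      permHom_bToAHom_one cs ct hi h]
  · rw [replaceFirst_of_eq_zero _ _ hi, replaceFirst_of_ne_zero _ _ hj, mul_one,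
      mul_inv_cancel] at himage
    exact absurd himage.symm (simple_ne_one ct j)
  · rw [replaceFirst_of_ne_zero _ _ hi, replaceFirst_of_eq_zero _ _ hj, mul_inv_eq_one,
      mul_eq_left] at himage
    exact absurd himage (simple_ne_one ct i)
  · rw [replaceFirst_of_ne_zero _ _ hi, replaceFirst_of_ne_zero _ _ hj] at himage
    exact smul_rankOne_of_conj ct himage

theorem rankOne_mul_bToAHom_smul (s t : Fin n) (g : W) :
    rankOne ct s * (bToAHom cs ct g • rankOne ct t) =
      rankOne ct s * (bToAHom cs ct (cs.simple s * g) • rankOne ct t) := by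
  rw [map_mul, bToAHom_simple, replaceFirst]
  split_ifs
  · rw [one_mul]
  · rw [mul_smul, rankOne_eq_pairSubsystem, rankOne_eq_pairSubsystem, smul_pairSubsystem,
      smul_pairSubsystem, permHom_simple, adjSwap, isTieFamily_pairSubsystem.mul_swap]

/-- The Juyumaya map from type `B_n` to type `A_n`. -/
def bToAJuyumaya : JuyumayaMap cs ct where
  φ := bToAHom cs ct
  e := rankOne ct
  equivariant _ _ _ := bToAHom_smul_rankOne cs ct
  mul_eq := rankOne_mul_bToAHom_smul cs ct

theorem isBtoA_bToAJuyumaya : IsBtoA (bToAJuyumaya cs ct) where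
  φ_simple := bToAHom_simple cs ct
  e_representative _ _ := rfl

variable {cs ct}

namespace IsBtoA

variable {J : JuyumayaMap cs ct} (hJ : IsBtoA J)

include hJ

theorem φ_simple_of_ne_zero {i : Fin n} (hi : i.val ≠ 0) : J.φ (cs.simple i) = ct.simple i := by
  rw [hJ.φ_simple, if_neg hi]

theorem e_eq_rankOne_of_val_eq_add_one {i j : Fin n} (hi : i.val ≠ 0) (hij : j.val = i.val + 1)
    (h : J.e i = rankOne ct i) : J.e j = rankOne ct j := by
  have hm : typeB n i j = 3 := by
    rw [typeB_eq_typeA hi (by omega), typeA_apply, if_neg fun h => by omega, if_pos (by omega)]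
  have hconj : cs.simple i * cs.simple j * cs.simple i * (cs.simple i * cs.simple j)⁻¹ =
      cs.simple j :=
    conj_eq_of_mul_pow_three (cs.simple_mul_simple_self i) (cs.simple_mul_simple_self j)
      (hm ▸ cs.simple_mul_simple_pow i j)
  have himage := congrArg J.φ hconj
  rw [map_mul, map_mul _ _ (cs.simple i), map_inv, hJ.φ_simple_of_ne_zero hi,
    hJ.φ_simple_of_ne_zero (i := j) (by omega)] at himage
  rw [← J.equivariant _ i j hconj, h, smul_rankOne_of_conj ct himage]

theorem e_eq_rankOne (i : Fin n) : J.e i = rankOne ct i := by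
  obtain ⟨k, hk⟩ := i
  induction k with
  | zero => exact hJ.e_representative _ (Nat.zero_le 1)
  | succ k ih =>
    rcases Nat.eq_zero_or_pos k with rfl | hpos
    · exact hJ.e_representative _ le_rfl
    · exact hJ.e_eq_rankOne_of_val_eq_add_one (i := ⟨k, Nat.lt_of_succ_lt hk⟩) hpos.ne' rfl (ih _)

theorem eq_bToAJuyumaya : J = bToAJuyumaya cs ct :=
  JuyumayaMap.ext
    (cs.ext_simple fun i => (hJ.φ_simple i).trans (bToAHom_simple cs ct i).symm)
    (funext hJ.e_eq_rankOne)

end IsBtoA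

variable (cs ct) in
theorem existsUnique_isBtoA : ∃! J : JuyumayaMap cs ct, IsBtoA J :=
  ⟨_, isBtoA_bToAJuyumaya cs ct, fun _ hJ => hJ.eq_bToAJuyumaya⟩

end BtoA

/-! ## Generators and universal property of Marin rings -/

theorem isUnit_of_mul_self {H : Type*} [Ring H] {a b : H} (ha : IsUnit a) (hab : Commute b a)
    (hb : b * b = a + (1 - a) * b) : IsUnit b := by
  have hinv : b * (b - (1 - a)) = a := by
    rw [mul_sub, hb, mul_sub, mul_one, hab.eq]
    noncomm_ring
  have hcomm : Commute b (b - (1 - a)) :=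
    (Commute.refl b).sub_right ((Commute.one_right b).sub_right hab)
  exact (hcomm.isUnit_mul_iff.1 (by rwa [hinv])).1

section MarinRing

variable {B : Type u} {M : CoxeterMatrix B} {W : Type v} [Group W]

theorem ArtinGroup.closure_range_gen : Subgroup.closure (Set.range (ArtinGroup.gen M)) = ⊤ :=
  PresentedGroup.closure_range_of _

theorem ArtinGroup.induction {p : ArtinGroup M → Prop} (z : ArtinGroup M) (one : p 1)
    (gen_mul : ∀ s z, p z → p (ArtinGroup.gen M s * z))
    (gen_inv_mul : ∀ s z, p z → p ((ArtinGroup.gen M s)⁻¹ * z)) : p z := by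
  have hz : z ∈ Subgroup.closure (Set.range (ArtinGroup.gen M)) := by
    rw [ArtinGroup.closure_range_gen]
    exact Subgroup.mem_top z
  induction hz using Subgroup.closure_induction_left with
  | one => exact one
  | mul_left _ hs z _ ih => obtain ⟨s, rfl⟩ := hs; exact gen_mul s z ih
  | inv_mul_cancel _ hs z _ ih => obtain ⟨s, rfl⟩ := hs; exact gen_inv_mul s z ih

/-- The homomorphism from the Artin group defined by a family that satisfies the braid relations. -/
def ArtinGroup.lift {G : Type*} [Group G] (γ : B → G)
    (hγ : ∀ s t, ((CoxeterSystem.alternatingWord s t (M s t)).map γ).prod =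
      ((CoxeterSystem.alternatingWord t s (M s t)).map γ).prod) : ArtinGroup M →* G :=
  PresentedGroup.toGroup (f := γ) (by
    rintro _ ⟨s, t, rfl⟩
    have lift_prod (l : List B) :
        FreeGroup.lift γ (l.map FreeGroup.of).prod = (l.map γ).prod := by
      simp only [map_list_prod, List.map_map, Function.comp_def, FreeGroup.lift_apply_of]
    rw [map_mul, map_inv, lift_prod, lift_prod, hγ, mul_inv_cancel])

theorem ArtinGroup.lift_gen {G : Type*} [Group G] (γ : B → G)
    (hγ : ∀ s t, ((CoxeterSystem.alternatingWord s t (M s t)).map γ).prod =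
      ((CoxeterSystem.alternatingWord t s (M s t)).map γ).prod) (s : B) :
    ArtinGroup.lift γ hγ (ArtinGroup.gen M s) = γ s :=
  PresentedGroup.toGroup.of _

theorem ArtinGroup.prod_map_alternatingWord (s t : B) :
    ((CoxeterSystem.alternatingWord s t (M s t)).map (ArtinGroup.gen M)).prod =
      ((CoxeterSystem.alternatingWord t s (M s t)).map (ArtinGroup.gen M)).prod := by
  have h := PresentedGroup.one_of_mem (rels := {r : FreeGroup B | ∃ s t : B,
    r = ((CoxeterSystem.alternatingWord s t (M s t)).map FreeGroup.of).prod *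
      ((CoxeterSystem.alternatingWord t s (M s t)).map FreeGroup.of).prod⁻¹}) ⟨s, t, rfl⟩
  rw [map_mul, map_inv, mul_inv_eq_one, map_list_prod, map_list_prod, List.map_map,
    List.map_map] at h
  exact h

namespace MarinDatum

variable {k : Type w} {cs : CoxeterSystem M W} {A : Type x} [CommRing k] [CommRing A] [Algebra k A]
variable (D : MarinDatum k cs A)

/-- The structure map from the coefficient ring `A` to the Marin ring. -/
def coeffHom : A →ₐ[k] D.MarinRing :=
  D.toMarinRing.comp (AlgHom.ofLinearMap
    { toFun := D.single 1
      map_add' := SkewMonoidAlgebra.single_add 1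
      map_smul' := fun r c => (D.smul_single r 1 c).symm }
    rfl
    fun c c' => by
      change D.single 1 (c * c') = D.single 1 c * D.single 1 c'
      rw [single_mul_single, map_one, map_one, AlgEquiv.one_apply, mul_one])

theorem coeffHom_apply (c : A) : D.coeffHom c = D.coeff c := rfl

/-- The homomorphism from the Artin group to the multiplicative monoid of the Marin ring. -/
def artinHom : ArtinGroup M →* D.MarinRing where
  toFun z := D.toMarinRing (D.single z 1)
  map_one' := map_one D.toMarinRing
  map_mul' z z' := by rw [← map_mul, single_mul_single, map_one, mul_one]

theorem artinHom_gen (s : B) : D.artinHom (ArtinGroup.gen M s) = D.g s := rfl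

theorem toMarinRing_single (z : ArtinGroup M) (c : A) :
    D.toMarinRing (D.single z c) = D.coeffHom c * D.artinHom z := by
  change _ = D.toMarinRing (D.single 1 c) * D.toMarinRing (D.single z 1)
  rw [← map_mul, single_mul_single, one_mul, map_one, mul_one]

theorem artinHom_mul_coeffHom (z : ArtinGroup M) (c : A) :
    D.artinHom z * D.coeffHom c = D.coeffHom (D.ρ (ArtinGroup.proj cs z) c) * D.artinHom z := by
  rw [← toMarinRing_single]
  change D.toMarinRing (D.single z 1) * D.toMarinRing (D.single 1 c) = _
  rw [← map_mul, single_mul_single, one_mul, mul_one]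

theorem g_mul_coeffHom (s : B) (c : A) :
    D.g s * D.coeffHom c = D.coeffHom (D.ρ (cs.simple s) c) * D.g s := by
  rw [← artinHom_gen, artinHom_mul_coeffHom, ArtinGroup.proj_gen]

theorem g_mul_g (s : B) :
    D.g s * D.g s = D.coeffHom (D.a s) + D.coeffHom (1 - D.a s) * D.g s := by
  have h : D.toMarinRing _ = D.toMarinRing _ :=
    RingQuot.mkAlgHom_rel k (HeckeRel.quadratic (D := D) s)
  rw [map_mul, map_add, map_mul] at h
  exact h

theorem g_mul_artinHom_gen_inv (s : B) : D.g s * D.artinHom (ArtinGroup.gen M s)⁻¹ = 1 := by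
  rw [← artinHom_gen, ← map_mul, mul_inv_cancel, map_one]

theorem artinHom_gen_inv (s : B) : D.artinHom (ArtinGroup.gen M s)⁻¹ =
    D.coeffHom ((D.a s)⁻¹ : Aˣ) * (D.g s - D.coeffHom (1 - D.a s)) := by
  have h : D.g s = D.coeffHom (D.a s) * D.artinHom (ArtinGroup.gen M s)⁻¹ +
      D.coeffHom (1 - D.a s) := by
    simpa only [add_mul, mul_assoc, g_mul_artinHom_gen_inv, mul_one] using
      congrArg (· * D.artinHom (ArtinGroup.gen M s)⁻¹) (D.g_mul_g s)
  rw [← eq_sub_of_add_eq h.symm, ← mul_assoc, ← map_mul, Units.inv_mul, map_one, one_mul]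

theorem eq_top_of_mem {S : Subalgebra k D.MarinRing} (hcoeff : ∀ c, D.coeffHom c ∈ S)
    (hg : ∀ s, D.g s ∈ S) : S = ⊤ := by
  have artinHom_mem (z : ArtinGroup M) : D.artinHom z ∈ S := by
    induction z using ArtinGroup.induction with
    | one => rw [map_one]; exact one_mem S
    | gen_mul s z ih => rw [map_mul]; exact mul_mem (hg s) ih
    | gen_inv_mul s z ih =>
      rw [map_mul, artinHom_gen_inv]
      exact mul_mem (mul_mem (hcoeff _) (sub_mem (hg s) (hcoeff _))) ih
  refine Algebra.eq_top_iff.2 fun z => ?_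
  obtain ⟨z, rfl⟩ := RingQuot.mkAlgHom_surjective k D.HeckeRel z
  change D.toMarinRing z ∈ S
  induction z using D.semidirect_induction with
  | single z c => rw [toMarinRing_single]; exact mul_mem (hcoeff c) (artinHom_mem z)
  | add z z' hz hz' => rw [map_add]; exact add_mem hz hz'

variable {H : Type y} [Ring H] [Algebra k H]

/-- The conditions under which a homomorphism `f` on the coefficient ring and a family `γ` extend to
a homomorphism on the Marin ring, with `g_s ↦ γ s`. -/
structure IsCompatible (f : A →ₐ[k] H) (γ : B → H) : Prop where
  braid : ∀ s t, ((CoxeterSystem.alternatingWord s t (M s t)).map γ).prod =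
    ((CoxeterSystem.alternatingWord t s (M s t)).map γ).prod
  mul_coeff : ∀ s c, γ s * f c = f (D.ρ (cs.simple s) c) * γ s
  quadratic : ∀ s, γ s * γ s = f (D.a s) + f (1 - D.a s) * γ s

namespace IsCompatible

variable {D} {f : A →ₐ[k] H} {γ : B → H} (h : D.IsCompatible f γ)
include h

theorem isUnit (s : B) : IsUnit (γ s) := by
  refine isUnit_of_mul_self ((D.a s).isUnit.map f) ?_ ?_
  · rw [commute_iff_eq, h.mul_coeff, D.equivariant _ s s (by simp)]
  · rw [h.quadratic, map_sub, map_one]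

/-- The homomorphism from the Artin group to the units of `H` defined by compatible data. -/
def artinLift : ArtinGroup M →* Hˣ :=
  ArtinGroup.lift (fun s => (h.isUnit s).unit) fun s t => Units.ext (by
    change Units.coeHom H _ = Units.coeHom H _
    rw [map_list_prod, map_list_prod, List.map_map, List.map_map]
    exact h.braid s t)

theorem artinLift_gen (s : B) : (h.artinLift (ArtinGroup.gen M s) : H) = γ s := by
  rw [artinLift, ArtinGroup.lift_gen, IsUnit.unit_spec]

theorem artinLift_mul_coeff (z : ArtinGroup M) (c : A) :
    h.artinLift z * f c = f (D.ρ (ArtinGroup.proj cs z) c) * h.artinLift z := by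
  induction z using ArtinGroup.induction generalizing c with
  | one => simp only [map_one, Units.val_one, one_mul, mul_one, AlgEquiv.one_apply]
  | gen_mul s z ih =>
    rw [map_mul, Units.val_mul, mul_assoc, ih, artinLift_gen, ← mul_assoc, h.mul_coeff, mul_assoc,
      map_mul, map_mul, ArtinGroup.proj_gen, AlgEquiv.mul_apply]
  | gen_inv_mul s z ih =>
    rw [← Units.mul_right_inj (h.artinLift (ArtinGroup.gen M s)), ← mul_assoc, ← Units.val_mul,
      ← map_mul, mul_inv_cancel_left, ih, artinLift_gen, ← mul_assoc, h.mul_coeff, mul_assoc,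
      ← artinLift_gen h s, ← Units.val_mul, ← map_mul, mul_inv_cancel_left, ← AlgEquiv.mul_apply,
      ← map_mul, ← ArtinGroup.proj_gen, ← map_mul, mul_inv_cancel_left]

/-- The extension of compatible data to the semidirect product of the coefficient ring and the
Artin group. -/
def semidirectRingLift : D.Semidirect →+* H :=
  letI := D.artinAction
  SkewMonoidAlgebra.liftNCRingHom (f : A →+* H)
    ((Units.coeHom H).comp h.artinLift)
    (fun {c z} => (h.artinLift_mul_coeff z c).symm)

theorem semidirectRingLift_single (z : ArtinGroup M) (c : A) :
    h.semidirectRingLift (D.single z c) = f c * h.artinLift z :=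
  SkewMonoidAlgebra.liftNC_single _ _ _ _

/-- The extension of compatible data to the Marin ring. -/
def lift : D.MarinRing →ₐ[k] H :=
  RingQuot.liftAlgHom k ⟨
    { h.semidirectRingLift with
      commutes' := fun r => by
        change h.semidirectRingLift (r • D.single 1 1) = _
        rw [smul_single, semidirectRingLift_single, map_smul, map_one, map_one, Units.val_one,
          mul_one, Algebra.algebraMap_eq_smul_one] }, by
    rintro _ _ ⟨s⟩
    change h.semidirectRingLift _ = h.semidirectRingLift _
    simp only [map_mul, map_add, semidirectRingLift_single, map_one, one_mul, mul_one,
      artinLift_gen, Units.val_one]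
    exact h.quadratic s⟩

theorem lift_toMarinRing_single (z : ArtinGroup M) (c : A) :
    h.lift (D.toMarinRing (D.single z c)) = f c * h.artinLift z :=
  (RingQuot.liftAlgHom_mkAlgHom_apply k _ _ _).trans (h.semidirectRingLift_single z c)

theorem lift_g (s : B) : h.lift (D.g s) = γ s := by
  rw [MarinDatum.g, lift_toMarinRing_single, map_one, one_mul, artinLift_gen]

theorem lift_coeff (c : A) : h.lift (D.coeff c) = f c := by
  rw [MarinDatum.coeff, lift_toMarinRing_single, map_one, Units.val_one, mul_one]

end IsCompatible

end MarinDatum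

end MarinRing

section Ties

variable {B : Type u} {M : CoxeterMatrix B} {W : Type v} [Group W]
variable {C : Type w} {N : CoxeterMatrix C} {U : Type x} [Group U]
variable {cs : CoxeterSystem M W} {ct : CoxeterSystem N U} (J : JuyumayaMap cs ct)
variable {R : Type y} [CommRing R] (u : B → Rˣ)
  (hu : ∀ (g : W) (s t : B), g * cs.simple s * g⁻¹ = cs.simple t → u s = u t)

namespace JuyumayaMap

/-- The homomorphism from the monoid of ties to the multiplicative monoid of the Marin ring. -/
def tieHom : J.tieMonoid →* (J.marinDatum u hu).MarinRing :=
  (J.marinDatum u hu).coeffHom.toMonoidHom.comp (MonoidAlgebra.of R J.tieMonoid)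

theorem tieHom_apply (Ψ : J.tieMonoid) : J.tieHom u hu Ψ = J.tieImage u hu Ψ := rfl

theorem marinDatum_ρ_of (g : W) (Ψ : J.tieMonoid) :
    (J.marinDatum u hu).ρ g (MonoidAlgebra.of R J.tieMonoid Ψ) =
      MonoidAlgebra.of R J.tieMonoid (J.tieAction g Ψ) := by
  simp [marinDatum, MonoidAlgebra.domCongrAut, MonoidAlgebra.domCongr]

theorem g_mul_tieImage (s : B) (Ψ : J.tieMonoid) :
    (J.marinDatum u hu).g s * J.tieImage u hu Ψ =
      J.tieImage u hu (J.tieAction (cs.simple s) Ψ) * (J.marinDatum u hu).g s := by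
  simp only [tieImage, ← MarinDatum.coeffHom_apply, MarinDatum.g_mul_coeffHom, marinDatum_ρ_of]

theorem coeffHom_hat (s : B) (r : R) : (J.marinDatum u hu).coeffHom (J.hat s r) =
    1 + (r - 1) • J.tieImage u hu (J.tie s) := by
  rw [hat, map_add, map_one, map_smul, MarinDatum.coeffHom_apply, tieImage]

theorem coeffHom_a (s : B) : (J.marinDatum u hu).coeffHom ((J.marinDatum u hu).a s) =
    1 + ((u s : R) - 1) • J.tieImage u hu (J.tie s) :=
  J.coeffHom_hat u hu s (u s)

theorem coeffHom_a_inv (s : B) :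
    (J.marinDatum u hu).coeffHom (((J.marinDatum u hu).a s)⁻¹ : (J.TieAlgebra R)ˣ) =
      1 + (((u s)⁻¹ : Rˣ) - 1 : R) • J.tieImage u hu (J.tie s) :=
  J.coeffHom_hat u hu s ((u s)⁻¹ : Rˣ)

section Generators

variable {u hu} {S : Subalgebra R (J.marinDatum u hu).MarinRing}
variable (hg : ∀ s, (J.marinDatum u hu).g s ∈ S) (htie : ∀ s, J.tieImage u hu (J.tie s) ∈ S)
include hg htie

theorem artinHom_gen_inv_mem (s : B) :
    (J.marinDatum u hu).artinHom (ArtinGroup.gen M s)⁻¹ ∈ S := by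
  rw [MarinDatum.artinHom_gen_inv, map_sub, map_one, coeffHom_a, coeffHom_a_inv]
  exact mul_mem (add_mem (one_mem S) (S.smul_mem (htie s) _))
    (sub_mem (hg s) (sub_mem (one_mem S) (add_mem (one_mem S) (S.smul_mem (htie s) _))))

theorem tieImage_tieAction_tie_mem (g : W) (s : B) :
    J.tieImage u hu (J.tieAction g (J.tie s)) ∈ S := by
  induction g using cs.simple_induction_left with
  | one => rw [map_one]; exact htie s
  | mul_simple_left g t ih =>
    have conj : J.tieImage u hu (J.tieAction (cs.simple t * g) (J.tie s)) =
        (J.marinDatum u hu).g t * J.tieImage u hu (J.tieAction g (J.tie s)) *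
          (J.marinDatum u hu).artinHom (ArtinGroup.gen M t)⁻¹ := by
      rw [g_mul_tieImage, mul_assoc, MarinDatum.g_mul_artinHom_gen_inv, mul_one, map_mul,
        MulAut.mul_apply]
    rw [conj]
    exact mul_mem (mul_mem (hg t) ih) (J.artinHom_gen_inv_mem hg htie t)

theorem tieImage_mem (Ψ : J.tieMonoid) : J.tieImage u hu Ψ ∈ S := by
  rw [← tieHom_apply]
  obtain ⟨Ψ, hΨ⟩ := Ψ
  induction hΨ using Submonoid.closure_induction with
  | mem Ψ h => obtain ⟨g, s, rfl⟩ := h; exact J.tieImage_tieAction_tie_mem hg htie g s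
  | one => exact (map_one (J.tieHom u hu)).symm ▸ one_mem S
  | mul Ψ Ψ' hΨ hΨ' ih ih' =>
    exact (map_mul (J.tieHom u hu) ⟨Ψ, hΨ⟩ ⟨Ψ', hΨ'⟩).symm ▸ mul_mem ih ih'

theorem eq_top_of_g_mem_of_tieImage_mem : S = ⊤ := by
  refine (J.marinDatum u hu).eq_top_of_mem (fun c => ?_) hg
  induction c using MonoidAlgebra.induction_on with
  | of Ψ => exact J.tieImage_mem hg htie Ψ
  | add c c' ih ih' => rw [map_add]; exact add_mem ih ih'
  | smul r c ih => rw [map_smul]; exact S.smul_mem ih r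

end Generators

theorem adjoin_g_tie_eq_top : Algebra.adjoin R
    (Set.range (J.marinDatum u hu).g ∪ Set.range fun s => J.tieImage u hu (J.tie s)) = ⊤ :=
  J.eq_top_of_g_mem_of_tieImage_mem (fun s => Algebra.subset_adjoin (Or.inl ⟨s, rfl⟩))
    fun s => Algebra.subset_adjoin (Or.inr ⟨s, rfl⟩)

end JuyumayaMap

end Ties

/-! ## Braid–tie systems -/

section AlternatingWords

variable {B : Type u} {G : Type v} [Monoid G] (f : B → G) (s t : B)

theorem prod_alternatingWord_two :
    ((CoxeterSystem.alternatingWord s t 2).map f).prod = f s * f t := by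
  simp [CoxeterSystem.alternatingWord]

theorem prod_alternatingWord_three :
    ((CoxeterSystem.alternatingWord s t 3).map f).prod = f t * f s * f t := by
  simp [CoxeterSystem.alternatingWord, mul_assoc]

theorem prod_alternatingWord_four :
    ((CoxeterSystem.alternatingWord s t 4).map f).prod = f s * f t * f s * f t := by
  simp [CoxeterSystem.alternatingWord, mul_assoc]

end AlternatingWords

section TypeB

variable {n : ℕ} {i j : Fin n}

theorem typeB_eq_two (h : 1 < gap i j) : typeB n i j = 2 := by
  rw [gap] at h
  rw [typeB_apply, if_neg (by rintro rfl; simp at h), if_neg (by omega), if_neg (by omega)]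

theorem typeB_eq_three (h : gap i j = 1) (h' : ¬IsFirstPair i j) : typeB n i j = 3 := by
  rw [gap] at h
  rw [typeB_apply, if_neg (by rintro rfl; simp at h), if_neg (by rwa [IsFirstPair] at h'),
    if_pos (by omega)]

theorem typeB_eq_four (h : IsFirstPair i j) : typeB n i j = 4 := by
  rw [IsFirstPair] at h
  rw [typeB_apply, if_neg (by rintro rfl; omega), if_pos h]

theorem ne_zero_of_gap_eq_one (h : gap i j = 1) (h' : ¬IsFirstPair i j) :
    i.val ≠ 0 ∧ j.val ≠ 0 := by
  rw [gap] at h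
  rw [IsFirstPair] at h'
  omega

theorem castSucc_eq_succ (h : j.val = i.val + 1) : j.castSucc = i.succ := Fin.ext h

theorem bSwap_castSucc (hi : i.val ≠ 0) : bSwap i i.castSucc = i.succ := by
  rw [bSwap_eq_adjSwap hi, adjSwap, Equiv.swap_apply_left]

theorem bSwap_succ (hi : i.val ≠ 0) : bSwap i i.succ = i.castSucc := by
  rw [bSwap_eq_adjSwap hi, adjSwap, Equiv.swap_apply_right]

theorem bSwap_castSucc_of_ne (h : j.val ≠ i.val) (h' : j.val ≠ i.val + 1) :
    bSwap i j.castSucc = j.castSucc :=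
  bSwap_apply_of_ne h h'

theorem bSwap_succ_of_ne (h : j.val ≠ i.val) (h' : j.val + 1 ≠ i.val) :
    bSwap i j.succ = j.succ :=
  bSwap_apply_of_ne h' (by simpa using h)

theorem bSwap_lt {a b : Fin (n + 1)} (ha : a < b) (hi : i.succ < b) : bSwap i a < b := by
  by_cases h₀ : i.val = 0
  · rwa [bSwap_eq_one h₀, Equiv.Perm.one_apply]
  rcases eq_or_ne a i.castSucc with rfl | h₁
  · rwa [bSwap_castSucc h₀]
  rcases eq_or_ne a i.succ with rfl | h₂
  · rw [bSwap_succ h₀]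
    exact Fin.castSucc_lt_succ.trans hi
  · rwa [bSwap_apply_of_ne (Fin.val_ne_of_ne h₁) (Fin.val_ne_of_ne h₂)]

theorem bSwap_bSwap_castSucc_succ (hi : i.val ≠ 0) (hj : j.val ≠ 0) (h : gap i j = 1) :
    bSwap j (bSwap i j.castSucc) = i.castSucc ∧ bSwap j (bSwap i j.succ) = i.succ := by
  rw [gap] at h
  rcases (by omega : j.val = i.val + 1 ∨ i.val = j.val + 1) with hij | hij
  · rw [castSucc_eq_succ hij, bSwap_succ hi, bSwap_castSucc_of_ne (by omega) (by omega),
      bSwap_succ_of_ne (by omega) (by omega), bSwap_succ hj, castSucc_eq_succ hij]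
    exact ⟨rfl, rfl⟩
  · rw [← castSucc_eq_succ hij, bSwap_castSucc hi, bSwap_castSucc_of_ne (by omega) (by omega),
      bSwap_castSucc hj, bSwap_succ_of_ne (by omega) (by omega), castSucc_eq_succ hij]
    exact ⟨rfl, rfl⟩

theorem bSwap_pair_induction {P : Fin (n + 1) → Fin (n + 1) → Prop} (refl : ∀ a, P a a)
    (symm : ∀ a b, P a b → P b a) (bSwap : ∀ i a b, P a b → P (bSwap i a) (bSwap i b))
    (adj : ∀ i : Fin n, i.val ≤ 1 → P i.castSucc i.succ) (a b : Fin (n + 1)) : P a b := by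
  have of_lt (b : Fin (n + 1)) : ∀ a < b, P a b := by
    induction b using Fin.induction with
    | zero => exact fun a ha => absurd ha (Fin.not_lt_zero a)
    | succ j ih =>
      intro a ha
      rcases (Fin.le_castSucc_iff.2 ha).eq_or_lt with rfl | hlt
      · rcases le_or_gt j.val 1 with hj | hj
        · exact adj j hj
        · obtain ⟨k, hk⟩ : ∃ k : Fin n, j.val = k.val + 1 :=
            ⟨⟨j.val - 1, by omega⟩, (Nat.sub_add_cancel (by omega)).symm⟩
          have h := ih k.castSucc (show k.val < j.val by omega)
          rw [castSucc_eq_succ hk] at h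
          obtain ⟨hcast, hsucc⟩ := bSwap_bSwap_castSucc_succ (i := j) (j := k) (by omega)
            (by omega) (by rw [gap]; omega)
          simpa only [hcast, hsucc] using bSwap k _ _ (bSwap j _ _ h)
      · have hlt' : a.val < j.val := hlt
        have h := bSwap j a j.castSucc (ih a hlt)
        rwa [bSwap_castSucc (by omega), bSwap_apply_of_ne (by omega) (by omega)] at h
  rcases lt_trichotomy a b with hab | rfl | hab
  · exact of_lt b a hab
  · exact refl a
  · exact symm b a (of_lt a b hab)

end TypeB

section System

variable {n : ℕ} {R : Type v} [CommRing R] {H : Type w} [Ring H] [Algebra R H]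

theorem IsTieFamily.map {α X Y : Type*} [Monoid X] [Monoid Y] {D : α → α → X} (hD : IsTieFamily D)
    (f : X →* Y) : IsTieFamily fun a b => f (D a b) where
  self a := by rw [hD.self, map_one]
  symm a b := by rw [hD.symm]
  commute a b c d := (hD.commute a b c d).map f
  triangle a b c := by rw [← map_mul, ← map_mul, hD.triangle]

/-- A braid–tie system: the structure common to Flores' algebra and to the Marin ring. It consists
of type `B` braid generators `g i` and of a tie family `D` on `{0, …, n}`, permuted by the `g i`,
such that `D (i - 1) i` is the tie in the quadratic relation of `g i` (in the labelling `1, …, n` of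
generators). -/
structure IsBraidTieSystem (u : Fin n → Rˣ) (g : Fin n → H) (D : Fin (n + 1) → Fin (n + 1) → H) :
    Prop extends IsTieFamily D where
  braid : ∀ i j, ((CoxeterSystem.alternatingWord i j (typeB n i j)).map g).prod =
    ((CoxeterSystem.alternatingWord j i (typeB n i j)).map g).prod
  quadratic : ∀ i, g i * g i = 1 + ((u i : R) - 1) • (D i.castSucc i.succ * (1 - g i))
  mul_tie : ∀ i a b, g i * D a b = D (bSwap i a) (bSwap i b) * g i

namespace IsBraidTieSystem

variable {u : Fin n → Rˣ} {g : Fin n → H} {D : Fin (n + 1) → Fin (n + 1) → H}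
  (h : IsBraidTieSystem u g D) {i j : Fin n}
include h

theorem tie_mul_bSwap (hj : j.val ≠ 0) (a b : Fin (n + 1)) :
    D j.castSucc j.succ * D (bSwap j a) (bSwap j b) = D j.castSucc j.succ * D a b := by
  rw [bSwap_eq_adjSwap hj, adjSwap, h.mul_swap]

theorem tie_mul_bSwap_of_gap_eq_one (hj : j.val ≠ 0) (hij : gap i j = 1) :
    D i.castSucc i.succ * D (bSwap j i.castSucc) (bSwap j i.succ) =
      D j.castSucc j.succ * D i.castSucc i.succ := by
  rw [gap] at hij
  rcases (by omega : j.val = i.val + 1 ∨ i.val = j.val + 1) with hij | hij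
  · rw [bSwap_castSucc_of_ne (by omega) (by omega), ← castSucc_eq_succ hij, bSwap_castSucc hj,
      h.commute j.castSucc, h.triangle]
  · rw [bSwap_succ_of_ne (by omega) (by omega), castSucc_eq_succ hij, bSwap_succ hj,
      h.triangle_right, h.commute]

theorem g_mul_g_of_one_lt_gap (hij : 1 < gap i j) : g i * g j = g j * g i := by
  simpa only [typeB_eq_two hij, prod_alternatingWord_two] using h.braid i j

theorem braid_first (hi : i.val = 0) (hj : j.val = 1) :
    g i * g j * g i * g j = g j * g i * g j * g i := by
  simpa only [typeB_eq_four (Or.inl ⟨hi, hj⟩), prod_alternatingWord_four] using h.braid i j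

theorem braid_of_gap_eq_one (hij : gap i j = 1) (hij' : ¬IsFirstPair i j) :
    g i * g j * g i = g j * g i * g j := by
  simpa only [typeB_eq_three hij hij', prod_alternatingWord_three] using (h.braid i j).symm

theorem g_mul_tie_self (i : Fin n) :
    g i * D i.castSucc i.succ = D i.castSucc i.succ * g i := by
  rw [h.mul_tie]
  by_cases hi : i.val = 0
  · rw [bSwap_eq_one hi, Equiv.Perm.one_apply, Equiv.Perm.one_apply]
  · rw [bSwap_castSucc hi, bSwap_succ hi, h.symm]

theorem g_mul_tie_of_gap_ne_one (hij : gap i j ≠ 1 ∨ i.val = 0 ∧ j.val = 1) :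
    g i * D j.castSucc j.succ = D j.castSucc j.succ * g i := by
  rcases eq_or_ne i j with rfl | hne
  · exact h.g_mul_tie_self i
  rw [h.mul_tie]
  by_cases hi : i.val = 0
  · rw [bSwap_eq_one hi, Equiv.Perm.one_apply, Equiv.Perm.one_apply]
  · rw [gap] at hij
    rw [bSwap_castSucc_of_ne (by omega) (by omega), bSwap_succ_of_ne (by omega) (by omega)]

theorem g_mul_g_mul_tie (hij : gap i j = 1) (hij' : ¬IsFirstPair i j) :
    g j * g i * D j.castSucc j.succ = D i.castSucc i.succ * g j * g i := by
  obtain ⟨hi, hj⟩ := ne_zero_of_gap_eq_one hij hij'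
  obtain ⟨hcast, hsucc⟩ := bSwap_bSwap_castSucc_succ hi hj hij
  rw [mul_assoc, h.mul_tie, ← mul_assoc, h.mul_tie, hcast, hsucc, mul_assoc]

theorem tie_mul_tie_mul_g (hj : j.val ≠ 0) : D i.castSucc i.succ * D j.castSucc j.succ * g j =
    D j.castSucc j.succ * g j * D i.castSucc i.succ := by
  rw [mul_assoc (D j.castSucc _), h.mul_tie, ← mul_assoc, h.tie_mul_bSwap hj, h.commute]

theorem tie_mul_g_mul_tie : D j.castSucc j.succ * g j * D i.castSucc i.succ =
    g j * D i.castSucc i.succ * D j.castSucc j.succ := by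
  rw [← h.g_mul_tie_self, mul_assoc, mul_assoc, h.commute]

theorem tie_mul_tie_mul_g_of_gap_eq_one (hij : gap i j = 1) (hij' : ¬IsFirstPair i j) :
    D j.castSucc j.succ * D i.castSucc i.succ * g j =
      D i.castSucc i.succ * g j * D i.castSucc i.succ := by
  rw [mul_assoc (D i.castSucc _), h.mul_tie, ← mul_assoc,
    h.tie_mul_bSwap_of_gap_eq_one (ne_zero_of_gap_eq_one hij hij').2 hij]

theorem tie_mul_g_mul_tie_of_gap_eq_one (hij : gap i j = 1) (hij' : ¬IsFirstPair i j) :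
    D i.castSucc i.succ * g j * D i.castSucc i.succ =
      g j * D i.castSucc i.succ * D j.castSucc j.succ := by
  rw [← h.tie_mul_tie_mul_g_of_gap_eq_one hij hij', h.commute,
    h.tie_mul_tie_mul_g (ne_zero_of_gap_eq_one hij hij').2, h.tie_mul_g_mul_tie]

theorem g_mul_zero_tie (hij : i.val = 0 ∨ 1 ≤ i.val ∧ j.val + 1 ≠ i.val ∧ j ≠ i) :
    g i * D 0 j.succ = D 0 j.succ * g i := by
  rw [h.mul_tie, bSwap_zero]
  by_cases hi : i.val = 0
  · rw [bSwap_eq_one hi, Equiv.Perm.one_apply]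
  · simp only [ne_eq, Fin.ext_iff] at hij
    rw [bSwap_succ_of_ne (by omega) (by omega)]

theorem g_mul_zero_tie_pred (hij : j.val + 1 = i.val) : g i * D 0 j.succ = D 0 i.succ * g i := by
  rw [h.mul_tie, bSwap_zero, ← castSucc_eq_succ hij.symm, bSwap_castSucc (by omega)]

theorem g_mul_zero_tie_self (hij : j.val + 1 = i.val) : g i * D 0 i.succ = D 0 j.succ * g i := by
  rw [h.mul_tie, bSwap_zero, bSwap_succ (by omega), castSucc_eq_succ hij.symm]

theorem tie_mul_zero_tie (hij : j.val = i.val + 1) :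
    D j.castSucc j.succ * D 0 i.succ = D j.castSucc j.succ * D 0 j.succ := by
  rw [castSucc_eq_succ hij, h.symm 0, h.symm i.succ, h.symm 0, h.triangle]

theorem tie_mul_zero_tie_eq_zero_tie_mul_zero_tie (hij : j.val = i.val + 1) :
    D j.castSucc j.succ * D 0 i.succ = D 0 j.succ * D 0 i.succ := by
  rw [castSucc_eq_succ hij, h.commute, h.triangle, h.commute]

omit h in
/-- The values of the generators of Flores' algebra in a braid–tie system: `e_i` is the tie of the
adjacent points `i - 1, i`, and `f_i` is the tie of the points `0, i`. -/
def genImage (g : Fin n → H) (D : Fin (n + 1) → Fin (n + 1) → H) : Gen n → H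
  | .g i => g i
  | .e i => D i.castSucc i.succ
  | .f i => D 0 i.succ

theorem lift_genImage_eq_of_floresRel {p q : FreeAlgebra R (Gen n)} (hpq : FloresRel u p q) :
    FreeAlgebra.lift R (genImage g D) p = FreeAlgebra.lift R (genImage g D) q := by
  cases hpq <;>
    simp only [gX, eX, fX, map_mul, map_add, map_sub, map_one, map_smul, FreeAlgebra.lift_ι_apply,
      genImage]
  case gg i j hij => exact h.g_mul_g_of_one_lt_gap hij
  case gggg i j hi hj => exact h.braid_first hi hj
  case ggg i j hij hij' => exact h.braid_of_gap_eq_one hij hij'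
  case quadratic i => exact h.quadratic i
  case ge i j hij => exact h.g_mul_tie_of_gap_ne_one hij
  case gge i j hij hij' => exact h.g_mul_g_mul_tie hij hij'
  case ee i j => exact h.commute _ _ _ _
  case e_sq i => exact h.mul_self _ _
  case eeg_ege i j hij hij' => exact h.tie_mul_tie_mul_g_of_gap_eq_one hij hij'
  case ege_gee i j hij hij' => exact h.tie_mul_g_mul_tie_of_gap_eq_one hij hij'
  case eeg_ege_first i j _ hj => exact h.tie_mul_tie_mul_g (by omega)
  case ege_gee_first i j _ _ => exact h.tie_mul_g_mul_tie
  case f_first i hi => rw [show i.castSucc = 0 from Fin.ext hi]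
  case gf i j hij => exact h.g_mul_zero_tie hij
  case ef i j => exact h.commute _ _ _ _
  case ff i j => exact h.commute _ _ _ _
  case gf_pred i j hij => exact h.g_mul_zero_tie_pred hij
  case gf_self i j hij => exact h.g_mul_zero_tie_self hij
  case ef_succ i j hij => exact h.tie_mul_zero_tie hij
  case ef_ff i j hij => exact h.tie_mul_zero_tie_eq_zero_tie_mul_zero_tie hij

/-- The homomorphism from Flores' algebra determined by a braid–tie system. -/
def floresLift : FloresAlgebra u →ₐ[R] H :=
  RingQuot.liftAlgHom R ⟨FreeAlgebra.lift R (genImage g D),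
    fun _ _ => h.lift_genImage_eq_of_floresRel⟩

theorem floresLift_mk (p : FreeAlgebra R (Gen n)) :
    h.floresLift (FloresAlgebra.mk u p) = FreeAlgebra.lift R (genImage g D) p :=
  RingQuot.liftAlgHom_mkAlgHom_apply R _ _ p

@[simp]
theorem floresLift_g (i : Fin n) : h.floresLift (FloresAlgebra.g u i) = g i :=
  (h.floresLift_mk _).trans (FreeAlgebra.lift_ι_apply _ _)

@[simp]
theorem floresLift_e (i : Fin n) : h.floresLift (FloresAlgebra.e u i) = D i.castSucc i.succ :=
  (h.floresLift_mk _).trans (FreeAlgebra.lift_ι_apply _ _)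

@[simp]
theorem floresLift_f (i : Fin n) : h.floresLift (FloresAlgebra.f u i) = D 0 i.succ :=
  (h.floresLift_mk _).trans (FreeAlgebra.lift_ι_apply _ _)

end IsBraidTieSystem
end System

/-! ## The Marin ring as a braid–tie system -/

theorem MarinDatum.prod_map_alternatingWord_g {B : Type u} {M : CoxeterMatrix B} {W : Type v}
    [Group W] {k : Type w} {cs : CoxeterSystem M W} {A : Type x} [CommRing k] [CommRing A]
    [Algebra k A] (D : MarinDatum k cs A) (s t : B) :
    ((CoxeterSystem.alternatingWord s t (M s t)).map D.g).prod =
      ((CoxeterSystem.alternatingWord t s (M s t)).map D.g).prod := by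
  have h := congrArg D.artinHom (ArtinGroup.prod_map_alternatingWord (M := M) s t)
  rwa [map_list_prod, map_list_prod, List.map_map, List.map_map] at h

section PairTies

variable {n : ℕ} {W : Type v} [Group W] {U : Type w} [Group U]
variable {cs : CoxeterSystem (typeB n) W} {ct : CoxeterSystem (CoxeterMatrix.A n) U}
variable {J : JuyumayaMap cs ct} (hJ : IsBtoA J)
include hJ

namespace IsBtoA

theorem permHom_φ_simple (i : Fin n) : permHom ct (J.φ (cs.simple i)) = bSwap i := by
  rw [hJ.eq_bToAJuyumaya]
  exact permHom_bToAHom_simple cs ct i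

theorem φ_simple_smul_pairSubsystem (i : Fin n) (a b : Fin (n + 1)) :
    J.φ (cs.simple i) • pairSubsystem ct a b = pairSubsystem ct (bSwap i a) (bSwap i b) := by
  rw [smul_pairSubsystem, hJ.permHom_φ_simple]

theorem pairSubsystem_mem_tieMonoid (a b : Fin (n + 1)) : pairSubsystem ct a b ∈ J.tieMonoid := by
  induction a, b using bSwap_pair_induction with
  | refl a =>
    rw [isTieFamily_pairSubsystem.self]
    exact one_mem _
  | symm a b h => rwa [isTieFamily_pairSubsystem.symm]
  | bSwap i a b h =>
    rw [← hJ.φ_simple_smul_pairSubsystem]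
    exact J.smul_mem_tieMonoid _ h
  | adj i _ =>
    rw [← rankOne_eq_pairSubsystem, ← hJ.e_eq_rankOne]
    exact (J.tie i).2

/-- The subsystem `pairSubsystem ct a b`, seen in the monoid of ties. -/
def pairTie (a b : Fin (n + 1)) : J.tieMonoid :=
  ⟨pairSubsystem ct a b, hJ.pairSubsystem_mem_tieMonoid a b⟩

theorem isTieFamily_pairTie : IsTieFamily hJ.pairTie where
  self a := Subtype.ext (isTieFamily_pairSubsystem.self a)
  symm a b := Subtype.ext (isTieFamily_pairSubsystem.symm a b)
  commute _ _ _ _ := Commute.all _ _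
  triangle a b c := Subtype.ext (isTieFamily_pairSubsystem.triangle a b c)

theorem tieAction_simple_pairTie (i : Fin n) (a b : Fin (n + 1)) :
    J.tieAction (cs.simple i) (hJ.pairTie a b) = hJ.pairTie (bSwap i a) (bSwap i b) :=
  Subtype.ext (hJ.φ_simple_smul_pairSubsystem i a b)

theorem tie_eq_pairTie (i : Fin n) : J.tie i = hJ.pairTie i.castSucc i.succ :=
  Subtype.ext ((hJ.e_eq_rankOne i).trans (rankOne_eq_pairSubsystem ct i))

theorem fTieAux_eq_pairTie (k : ℕ) (hk : k < n) :
    fTieAux J k hk = hJ.pairTie 0 (Fin.succ ⟨k, hk⟩) := by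
  induction k with
  | zero => exact hJ.tie_eq_pairTie _
  | succ k ih =>
    rw [fTieAux, ih, tieAction_simple_pairTie, bSwap_zero,
      ← castSucc_eq_succ (i := ⟨k, Nat.lt_of_succ_lt hk⟩) (j := ⟨k + 1, hk⟩) rfl,
      bSwap_castSucc (Nat.succ_ne_zero k)]

theorem fTie_eq_pairTie (i : Fin n) : fTie J i = hJ.pairTie 0 i.succ :=
  hJ.fTieAux_eq_pairTie i.val i.isLt

variable {R : Type y} [CommRing R] (u : Fin n → Rˣ)
  (hu : ∀ (g : W) (s t : Fin n), g * cs.simple s * g⁻¹ = cs.simple t → u s = u t)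

theorem isBraidTieSystem_marinDatum : IsBraidTieSystem u (J.marinDatum u hu).g
    fun a b => J.tieImage u hu (hJ.pairTie a b) where
  toIsTieFamily := hJ.isTieFamily_pairTie.map (J.tieHom u hu)
  braid := (J.marinDatum u hu).prod_map_alternatingWord_g
  quadratic i := by
    rw [← hJ.tie_eq_pairTie, MarinDatum.g_mul_g, map_sub, map_one, J.coeffHom_a, mul_sub, mul_one,
      smul_sub, ← smul_mul_assoc]
    noncomm_ring
  mul_tie i a b := by rw [J.g_mul_tieImage, hJ.tieAction_simple_pairTie]

end IsBtoA

namespace IsBraidTieSystem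

variable {R : Type y} [CommRing R] {H : Type x} [Ring H] [Algebra R H] {u : Fin n → Rˣ}
  (hu : ∀ (g : W) (s t : Fin n), g * cs.simple s * g⁻¹ = cs.simple t → u s = u t)
  {g : Fin n → H} {D : Fin (n + 1) → Fin (n + 1) → H} (h : IsBraidTieSystem u g D)
include h

theorem g_mul_rootSubsystemHom (i : Fin n) {Ψ : RootSubsystem ct} (hΨ : Ψ ∈ J.tieMonoid) :
    g i * h.rootSubsystemHom ct Ψ =
      h.rootSubsystemHom ct (J.φ (cs.simple i) • Ψ) * g i := by
  induction hΨ using Submonoid.closure_induction with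
  | mem Ψ hΨ =>
    obtain ⟨w, s, rfl⟩ := hΨ
    rw [hJ.e_eq_rankOne, rankOne_eq_pairSubsystem, smul_pairSubsystem,
      hJ.φ_simple_smul_pairSubsystem, h.rootSubsystemHom_pairSubsystem,
      h.rootSubsystemHom_pairSubsystem, h.mul_tie]
  | one => rw [smul_one, map_one, mul_one, one_mul]
  | mul Ψ Ψ' _ _ ih ih' =>
    rw [smul_mul', map_mul, map_mul, ← mul_assoc, ih, mul_assoc, ih', mul_assoc]

omit hJ in
/-- The homomorphism on the algebra of ties determined by a braid–tie system. -/
def coeffLift (J : JuyumayaMap cs ct) : J.TieAlgebra R →ₐ[R] H :=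
  MonoidAlgebra.lift R H J.tieMonoid ((h.rootSubsystemHom ct).comp J.tieMonoid.subtype)

omit hJ in
theorem coeffLift_of (Ψ : J.tieMonoid) :
    h.coeffLift J (MonoidAlgebra.of R J.tieMonoid Ψ) = h.rootSubsystemHom ct Ψ :=
  MonoidAlgebra.lift_of _ _

theorem coeffLift_pairTie (a b : Fin (n + 1)) :
    h.coeffLift J (MonoidAlgebra.of R J.tieMonoid (hJ.pairTie a b)) = D a b :=
  (h.coeffLift_of _).trans (h.rootSubsystemHom_pairSubsystem a b)

theorem coeffLift_a (i : Fin n) : h.coeffLift J ((J.marinDatum u hu).a i) =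
    1 + ((u i : R) - 1) • D i.castSucc i.succ := by
  change h.coeffLift J (J.hat i (u i)) = _
  rw [JuyumayaMap.hat, map_add, map_one, map_smul, hJ.tie_eq_pairTie, h.coeffLift_pairTie hJ]

theorem isCompatible_coeffLift : (J.marinDatum u hu).IsCompatible (h.coeffLift J) g where
  braid := h.braid
  mul_coeff i c := by
    induction c using MonoidAlgebra.induction_on with
    | of Ψ =>
      rw [J.marinDatum_ρ_of, h.coeffLift_of, h.coeffLift_of]
      exact h.g_mul_rootSubsystemHom hJ i Ψ.2
    | add c c' ih ih' => rw [map_add, map_add, map_add, mul_add, ih, ih', add_mul]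
    | smul r c ih => rw [map_smul, map_smul, map_smul, mul_smul_comm, ih, smul_mul_assoc]
  quadratic i := by
    rw [h.quadratic, map_sub, map_one, h.coeffLift_a hJ hu, mul_sub, mul_one, smul_sub,
      ← smul_mul_assoc]
    noncomm_ring

/-- The homomorphism from the Marin ring determined by a braid–tie system. -/
def marinLift : (J.marinDatum u hu).MarinRing →ₐ[R] H :=
  (h.isCompatible_coeffLift hJ hu).lift

theorem marinLift_g (i : Fin n) : h.marinLift hJ hu ((J.marinDatum u hu).g i) = g i :=
  (h.isCompatible_coeffLift hJ hu).lift_g i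

theorem marinLift_tieImage (a b : Fin (n + 1)) :
    h.marinLift hJ hu (J.tieImage u hu (hJ.pairTie a b)) = D a b :=
  ((h.isCompatible_coeffLift hJ hu).lift_coeff _).trans (h.coeffLift_pairTie hJ a b)

end IsBraidTieSystem

end PairTies

/-! ## Conjugation by the generators of Flores' algebra -/

theorem isUnit_one_add_smul {R : Type u} {H : Type v} [CommRing R] [Ring H] [Algebra R H] {a : H}
    (ha : a * a = a) (r : Rˣ) : IsUnit (1 + ((r : R) - 1) • a) := by
  have mul_eq_one {r r' : R} (h : r * r' = 1) : (1 + (r - 1) • a) * (1 + (r' - 1) • a) = 1 := by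
    have hr : (r' - 1) + ((r - 1) + (r - 1) * (r' - 1)) = 0 := by linear_combination h
    rw [mul_add, mul_one, add_mul, one_mul, smul_mul_smul_comm, ha, add_assoc, add_comm (_ • a),
      add_assoc, ← add_smul, ← add_smul, add_comm (_ * _), hr, zero_smul, add_zero]
  exact ⟨⟨_, 1 + (((r⁻¹ : Rˣ) : R) - 1) • a, mul_eq_one r.mul_inv, mul_eq_one r.inv_mul⟩, rfl⟩

theorem toConjAct_smul_eq_iff {H : Type u} [Monoid H] {z : Hˣ} {a b : H} :
    ConjAct.toConjAct z • a = b ↔ z * a = b * z := by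
  rw [ConjAct.units_smul_def, ConjAct.ofConjAct_toConjAct, Units.mul_inv_eq_iff_eq_mul]

namespace FloresAlgebra

variable {n : ℕ} {R : Type y} [CommRing R] (u : Fin n → Rˣ) {i j : Fin n}

theorem mk_eq_of_rel {p q : FreeAlgebra R (Gen n)} (h : FloresRel u p q) : mk u p = mk u q :=
  RingQuot.mkAlgHom_rel R h

theorem g_mul_g_self (i : Fin n) :
    g u i * g u i = 1 + ((u i : R) - 1) • (e u i * (1 - g u i)) := by
  simpa only [g, e, map_mul, map_add, map_one, map_smul, map_sub]
    using mk_eq_of_rel u (.quadratic i)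

theorem g_mul_g_comm (h : 1 < gap i j) : g u i * g u j = g u j * g u i := by
  simpa only [g, map_mul] using mk_eq_of_rel u (.gg i j h)

theorem g_mul_g_mul_g (h : gap i j = 1) (h' : ¬IsFirstPair i j) :
    g u i * g u j * g u i = g u j * g u i * g u j := by
  simpa only [g, map_mul] using mk_eq_of_rel u (.ggg i j h h')

theorem g_mul_g_mul_g_mul_g (hi : i.val = 0) (hj : j.val = 1) :
    g u i * g u j * g u i * g u j = g u j * g u i * g u j * g u i := by
  simpa only [g, map_mul] using mk_eq_of_rel u (.gggg i j hi hj)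

theorem e_mul_self (i : Fin n) : e u i * e u i = e u i := by
  simpa only [e, map_mul] using mk_eq_of_rel u (.e_sq i)

theorem e_mul_e_comm (i j : Fin n) : e u i * e u j = e u j * e u i := by
  simpa only [e, map_mul] using mk_eq_of_rel u (.ee i j)

theorem e_mul_f_comm (i j : Fin n) : e u i * f u j = f u j * e u i := by
  simpa only [e, f, map_mul] using mk_eq_of_rel u (.ef i j)

theorem f_mul_f_comm (i j : Fin n) : f u i * f u j = f u j * f u i := by
  simpa only [f, map_mul] using mk_eq_of_rel u (.ff i j)

theorem f_eq_e (hi : i.val = 0) : f u i = e u i := mk_eq_of_rel u (.f_first i hi)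

theorem e_mul_f_pred (h : j.val = i.val + 1) : e u j * f u i = e u j * f u j := by
  simpa only [e, f, map_mul] using mk_eq_of_rel u (.ef_succ i j h)

theorem e_mul_f_pred_eq_f_mul_f (h : j.val = i.val + 1) : e u j * f u i = f u j * f u i := by
  simpa only [e, f, map_mul] using mk_eq_of_rel u (.ef_ff i j h)

theorem g_mul_e (h : gap i j ≠ 1 ∨ i.val = 0 ∧ j.val = 1) : g u i * e u j = e u j * g u i := by
  simpa only [g, e, map_mul] using mk_eq_of_rel u (.ge i j h)

theorem g_mul_e_self (i : Fin n) : g u i * e u i = e u i * g u i :=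
  g_mul_e u (Or.inl (by simp [gap]))

theorem e_mul_e_mul_g (h : gap i j = 1) (h' : ¬IsFirstPair i j) :
    e u j * e u i * g u j = e u i * g u j * e u i := by
  simpa only [g, e, map_mul] using mk_eq_of_rel u (.eeg_ege i j h h')

theorem e_mul_g_mul_e (h : gap i j = 1) (h' : ¬IsFirstPair i j) :
    e u i * g u j * e u i = g u j * e u i * e u j := by
  simpa only [g, e, map_mul] using mk_eq_of_rel u (.ege_gee i j h h')

theorem isUnit_g (i : Fin n) : IsUnit (g u i) := by
  refine isUnit_of_mul_self (isUnit_one_add_smul (e_mul_self u i) (u i)) ?_ ?_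
  · exact (Commute.one_right _).add_right (Commute.smul_right (g_mul_e_self u i) _)
  · rw [g_mul_g_self, mul_sub, mul_one, smul_sub, ← smul_mul_assoc]
    noncomm_ring

theorem commute_g_mul_g_e (h : gap i j = 1) (h' : ¬IsFirstPair i j) :
    Commute (g u j * g u j) (e u i) := by
  have key : e u j * g u j * e u i = e u i * (e u j * g u j) := by
    rw [← g_mul_e_self, mul_assoc, e_mul_e_comm, ← mul_assoc, ← e_mul_g_mul_e u h h',
      ← e_mul_e_mul_g u h h', g_mul_e_self, ← mul_assoc, e_mul_e_comm]
  have hcomm : Commute (e u j * (1 - g u j)) (e u i) := by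
    rw [mul_sub, mul_one]
    exact Commute.sub_left (e_mul_e_comm u j i) key
  rw [g_mul_g_self]
  exact (Commute.one_left _).add_left (hcomm.smul_left _)

/-- Conjugation by the invertible generator `g_i`. -/
def conjG (i : Fin n) : ConjAct (FloresAlgebra u)ˣ := ConjAct.toConjAct (isUnit_g u i).unit

theorem conjG_smul_eq_iff {a b : FloresAlgebra u} :
    conjG u i • a = b ↔ g u i * a = b * g u i :=
  toConjAct_smul_eq_iff

theorem conjG_mul_conjG_comm (h : 1 < gap i j) :
    conjG u i * conjG u j = conjG u j * conjG u i :=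
  congrArg ConjAct.toConjAct (Units.ext (g_mul_g_comm u h))

theorem conjG_braid (h : gap i j = 1) (h' : ¬IsFirstPair i j) :
    conjG u i * conjG u j * conjG u i = conjG u j * conjG u i * conjG u j :=
  congrArg ConjAct.toConjAct (Units.ext (g_mul_g_mul_g u h h'))

theorem conjG_smul_e (h : gap i j ≠ 1 ∨ i.val = 0 ∧ j.val = 1) : conjG u i • e u j = e u j :=
  (conjG_smul_eq_iff u).2 (g_mul_e u h)

theorem conjG_smul_conjG_smul_e (h : gap i j = 1) (h' : ¬IsFirstPair i j) :
    conjG u j • conjG u i • e u j = e u i := by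
  rw [smul_smul]
  refine toConjAct_smul_eq_iff.2 ?_
  change g u j * g u i * e u j = e u i * (g u j * g u i)
  simpa only [g, e, map_mul, mul_assoc] using mk_eq_of_rel u (.gge i j h h')

theorem conjG_smul_conjG_smul_e_self (h : gap i j = 1) (h' : ¬IsFirstPair i j) :
    conjG u j • conjG u j • e u i = e u i := by
  rw [smul_smul]
  exact toConjAct_smul_eq_iff.2 (commute_g_mul_g_e u h h')

theorem e_mul_conjG_smul_e (h : gap i j = 1) (h' : ¬IsFirstPair i j) :
    e u i * conjG u j • e u i = e u i * e u j := by
  rw [← (isUnit_g u j).mul_left_inj, mul_assoc, ← (conjG_smul_eq_iff u).1 rfl, ← mul_assoc,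
    ← e_mul_e_mul_g u h h', e_mul_e_comm]

theorem conjG_smul_f (h : i.val = 0 ∨ 1 ≤ i.val ∧ j.val + 1 ≠ i.val ∧ j ≠ i) :
    conjG u i • f u j = f u j := by
  rw [conjG_smul_eq_iff]
  simpa only [g, f, map_mul] using mk_eq_of_rel u (.gf i j h)

theorem conjG_smul_f_pred (h : j.val + 1 = i.val) : conjG u i • f u j = f u i := by
  rw [conjG_smul_eq_iff]
  simpa only [g, f, map_mul] using mk_eq_of_rel u (.gf_pred i j h)

theorem conjG_smul_f_self (h : j.val + 1 = i.val) : conjG u i • f u i = f u j := by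
  rw [conjG_smul_eq_iff]
  simpa only [g, f, map_mul] using mk_eq_of_rel u (.gf_self i j h)

end FloresAlgebra

/-! ## Flores' algebra as a braid–tie system -/

section Braid

variable {G : Type u} {X : Type v} [Monoid G] [MulAction G X] {z w : G} {x : X}

theorem smul_smul_smul_eq_of_braid (h : z * w * z = w * z * w) (hw : w • x = x) :
    z • w • z • x = w • z • x := by
  rw [← mul_smul, ← mul_smul, h, mul_smul, mul_smul, hw]

theorem smul_smul_smul_eq_smul_of_braid (h : z * w * z = w * z * w) (hw : w • x = x)
    (hz : z • z • x = x) : w • w • z • x = z • x := by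
  calc w • w • z • x = w • (w * z * w) • x := by rw [mul_smul, mul_smul, hw]
    _ = w • (z * w * z) • x := by rw [h]
    _ = (w * z * w) • z • x := by simp only [mul_smul]
    _ = z • w • z • z • x := by rw [← h, mul_smul, mul_smul]
    _ = z • x := by rw [hz, hw]

end Braid

theorem commute_smul_smul_iff {G : Type u} {X : Type v} [Group G] [Monoid X]
    [MulDistribMulAction G X] (z : G) {x y : X} : Commute (z • x) (z • y) ↔ Commute x y := by
  rw [Commute, SemiconjBy, ← smul_mul', ← smul_mul', smul_left_cancel_iff, Commute, SemiconjBy]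

namespace FloresAlgebra

variable {n : ℕ} {R : Type y} [CommRing R] (u : Fin n → Rˣ) {i j : Fin n} {a b : Fin (n + 1)}

/-- The tie of the points `a < b`, obtained from the adjacent tie of `a` and `a + 1` by moving the
second point upwards one step at a time. The value is `1` for `b ≤ a`. -/
def orderedTie (a : Fin (n + 1)) : Fin (n + 1) → FloresAlgebra u :=
  Fin.induction 1 fun i x => if a = i.castSucc then e u i else conjG u i • x

theorem orderedTie_succ (a : Fin (n + 1)) (i : Fin n) : orderedTie u a i.succ =
    if a = i.castSucc then e u i else conjG u i • orderedTie u a i.castSucc := rfl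

theorem orderedTie_of_le (h : b ≤ a) : orderedTie u a b = 1 := by
  induction b using Fin.induction with
  | zero => rfl
  | succ i ih =>
    have hlt : i.castSucc < a := Fin.castSucc_lt_succ.trans_le h
    rw [orderedTie_succ, if_neg hlt.ne', ih hlt.le, smul_one]

/-- The tie of the points `a` and `b` in Flores' algebra. -/
def tie (a b : Fin (n + 1)) : FloresAlgebra u := orderedTie u a b * orderedTie u b a

theorem tie_self (a : Fin (n + 1)) : tie u a a = 1 := by
  rw [tie, orderedTie_of_le u le_rfl, mul_one]

theorem tie_comm (a b : Fin (n + 1)) : tie u a b = tie u b a := by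
  rcases le_total a b with h | h <;> rw [tie, tie, orderedTie_of_le u h, mul_one, one_mul]

theorem tie_castSucc_succ (i : Fin n) : tie u i.castSucc i.succ = e u i := by
  rw [tie, orderedTie_succ, if_pos rfl, orderedTie_of_le u Fin.castSucc_lt_succ.le, mul_one]

theorem tie_succ (h : a < i.castSucc) : tie u a i.succ = conjG u i • tie u a i.castSucc := by
  rw [tie, tie, orderedTie_succ, if_neg h.ne, orderedTie_of_le u h.le,
    orderedTie_of_le u (h.trans Fin.castSucc_lt_succ).le, mul_one, mul_one]

theorem tie_zero_succ (i : Fin n) : tie u 0 i.succ = f u i := by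
  obtain ⟨k, hk⟩ := i
  induction k with
  | zero => exact (tie_castSucc_succ u ⟨0, hk⟩).trans (f_eq_e u rfl).symm
  | succ k ih =>
    rw [tie_succ u (Nat.succ_pos k), castSucc_eq_succ (i := ⟨k, Nat.lt_of_succ_lt hk⟩) rfl, ih,
      conjG_smul_f_pred u rfl]

/-! ### Equivariance -/

theorem conjG_smul_tie_of_lt_of_lt (hab : a < b) (hbi : b.val < i.val) :
    conjG u i • tie u a b = tie u a b := by
  induction b using Fin.induction with
  | zero => exact absurd hab (Fin.not_lt_zero a)
  | succ j ih =>
    have hgap : 1 < gap i j := by rw [Fin.val_succ] at hbi; rw [gap]; omega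
    rcases (Fin.le_castSucc_iff.2 hab).eq_or_lt with rfl | hlt
    · rw [tie_castSucc_succ, conjG_smul_e u (Or.inl hgap.ne')]
    · rw [tie_succ u hlt, smul_smul, conjG_mul_conjG_comm u hgap, mul_smul,
        ih hlt ((Nat.lt_succ_self _).trans hbi)]

theorem conjG_smul_conjG_smul_tie (hab : a < b) (hbi : b.val = i.val) :
    conjG u i • conjG u i • tie u a b = tie u a b := by
  induction b using Fin.induction generalizing i with
  | zero => exact absurd hab (Fin.not_lt_zero a)
  | succ j ih =>
    rw [Fin.val_succ] at hbi
    have hgap : gap j i = 1 := by rw [gap]; omega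
    by_cases hj : j.val = 0
    · obtain rfl : a = 0 := Fin.ext (by simpa [hj] using show a.val < j.val + 1 from hab)
      rw [tie_zero_succ, conjG_smul_f_pred u hbi, conjG_smul_f_self u hbi]
    have hfirst : ¬IsFirstPair j i := by rw [IsFirstPair]; omega
    rcases (Fin.le_castSucc_iff.2 hab).eq_or_lt with rfl | hlt
    · rw [tie_castSucc_succ, conjG_smul_conjG_smul_e_self u hgap hfirst]
    · rw [tie_succ u hlt]
      exact smul_smul_smul_eq_smul_of_braid (conjG_braid u hgap hfirst)
        (conjG_smul_tie_of_lt_of_lt u hlt (show j.val < i.val by omega)) (ih hlt rfl)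

theorem conjG_succ_smul_e (hi : i.val ≠ 0) (hij : j.val = i.val + 1) :
    conjG u i • e u j = conjG u j • e u i := by
  have hgap : gap j i = 1 := by rw [gap]; omega
  have hfirst : ¬IsFirstPair j i := by rw [IsFirstPair]; omega
  have h : conjG u i • conjG u i • e u j = conjG u i • conjG u j • e u i := by
    rw [conjG_smul_conjG_smul_e_self u hgap hfirst, conjG_smul_conjG_smul_e u hgap hfirst]
  exact smul_left_cancel _ h

theorem conjG_smul_e_eq_tie (hi : i.val ≠ 0) :
    conjG u i • e u j = tie u (bSwap i j.castSucc) (bSwap i j.succ) := by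
  rcases (by omega : i.val = j.val ∨ i.val = j.val + 1 ∨ j.val = i.val + 1 ∨
    (i.val ≠ j.val ∧ i.val ≠ j.val + 1 ∧ j.val ≠ i.val + 1)) with hij | hij | hij | ⟨h, h', h''⟩
  · obtain rfl := Fin.ext hij
    rw [bSwap_castSucc hi, bSwap_succ hi, tie_comm, tie_castSucc_succ,
      conjG_smul_e u (Or.inl (by simp [gap]))]
  · rw [bSwap_castSucc_of_ne (by omega) (by omega), ← castSucc_eq_succ hij, bSwap_castSucc hi,
      tie_succ u (show j.val < i.val by omega), castSucc_eq_succ hij, tie_castSucc_succ]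
  · rw [bSwap_succ_of_ne (by omega) (by omega), castSucc_eq_succ hij, bSwap_succ hi,
      tie_succ u (show i.val < j.val by omega), castSucc_eq_succ hij, tie_castSucc_succ,
      conjG_succ_smul_e u hi hij]
  · rw [bSwap_castSucc_of_ne h.symm h'', bSwap_succ_of_ne h.symm h'.symm, tie_castSucc_succ,
      conjG_smul_e u (Or.inl (by rw [gap]; omega))]

theorem conjG_smul_tie_succ (hi : i.val ≠ 0) (hij : j.val = i.val + 1) (ha : a < j.castSucc) :
    conjG u i • tie u a j.succ = tie u (bSwap i a) j.succ := by
  have hgap : gap i j = 1 := by rw [gap]; omega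
  have hfirst : ¬IsFirstPair i j := by rw [IsFirstPair]; omega
  rw [tie_succ u ha, castSucc_eq_succ hij]
  rw [castSucc_eq_succ hij] at ha
  rcases (Fin.le_castSucc_iff.2 ha).eq_or_lt with rfl | hlt
  · rw [bSwap_castSucc hi, tie_castSucc_succ, ← castSucc_eq_succ hij, tie_castSucc_succ]
    exact conjG_smul_conjG_smul_e u (by rw [gap]; omega) (by rw [IsFirstPair]; omega)
  · have hai : a.val < i.val := hlt
    rw [tie_succ u hlt, bSwap_apply_of_ne (by omega) (by omega),
      smul_smul_smul_eq_of_braid (conjG_braid u hgap hfirst), tie_succ u, castSucc_eq_succ hij,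
      tie_succ u hlt]
    · exact show a.val < j.val by omega
    · exact conjG_smul_tie_of_lt_of_lt u hlt (show i.val < j.val by omega)

theorem conjG_smul_tie_of_lt (hi : i.val ≠ 0) (hab : a < b) :
    conjG u i • tie u a b = tie u (bSwap i a) (bSwap i b) := by
  induction b using Fin.induction with
  | zero => exact absurd hab (Fin.not_lt_zero a)
  | succ j ih =>
    rcases (Fin.le_castSucc_iff.2 hab).eq_or_lt with rfl | hlt
    · rw [tie_castSucc_succ, conjG_smul_e_eq_tie u hi]
    have haj : a.val < j.val := hlt
    rcases (by omega : j.val + 1 < i.val ∨ i.val = j.val + 1 ∨ i.val = j.val ∨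
      j.val = i.val + 1 ∨ i.val + 1 < j.val) with hij | hij | hij | hij | hij
    · rw [conjG_smul_tie_of_lt_of_lt u hab hij, bSwap_apply_of_ne (by omega) (by omega),
        bSwap_succ_of_ne (by omega) (by omega)]
    · rw [bSwap_apply_of_ne (x := a) (by omega) (by omega), ← castSucc_eq_succ hij,
        bSwap_castSucc hi, tie_succ u (show a.val < i.val by omega)]
    · obtain rfl := Fin.ext hij
      rw [tie_succ u hlt, conjG_smul_conjG_smul_tie u hlt rfl, bSwap_succ hi,
        bSwap_apply_of_ne (by omega) (by omega)]
    · rw [bSwap_succ_of_ne (by omega) (by omega)]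
      exact conjG_smul_tie_succ u hi hij hlt
    · have hgap : 1 < gap i j := by rw [gap]; omega
      have hlt' : bSwap i a < j.castSucc := bSwap_lt hlt hij
      have h := ih hlt
      rw [bSwap_castSucc_of_ne (by omega) (by omega)] at h
      rw [tie_succ u hlt, smul_smul, conjG_mul_conjG_comm u hgap, mul_smul, h,
        bSwap_succ_of_ne (by omega) (by omega), tie_succ u hlt']

theorem conjG_smul_tie_of_val_eq_zero (hi : i.val = 0) (hab : a < b) :
    conjG u i • tie u a b = tie u a b := by
  induction b using Fin.induction with
  | zero => exact absurd hab (Fin.not_lt_zero a)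
  | succ j ih =>
    rcases (Fin.le_castSucc_iff.2 hab).eq_or_lt with rfl | hlt
    · rw [tie_castSucc_succ, conjG_smul_e u (by rw [gap]; omega)]
    have haj : a.val < j.val := hlt
    rcases eq_or_ne a 0 with rfl | ha
    · rw [tie_zero_succ, conjG_smul_f u (Or.inl hi)]
    · have ha' : a.val ≠ 0 := Fin.val_ne_of_ne ha
      rw [tie_succ u hlt, smul_smul, conjG_mul_conjG_comm u (by rw [gap]; omega), mul_smul, ih hlt]

theorem conjG_smul_tie (i : Fin n) (a b : Fin (n + 1)) :
    conjG u i • tie u a b = tie u (bSwap i a) (bSwap i b) := by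
  have of_lt {a b : Fin (n + 1)} (hab : a < b) :
      conjG u i • tie u a b = tie u (bSwap i a) (bSwap i b) := by
    by_cases hi : i.val = 0
    · rw [bSwap_eq_one hi]
      exact conjG_smul_tie_of_val_eq_zero u hi hab
    · exact conjG_smul_tie_of_lt u hi hab
  rcases lt_trichotomy a b with hab | rfl | hab
  · exact of_lt hab
  · rw [tie_self, tie_self, smul_one]
  · rw [tie_comm, of_lt hab, tie_comm]

/-! ### The ties form a tie family -/

theorem commute_e_conjG_smul_e (hi : i.val ≠ 0) (hij : j.val = i.val + 1) :
    Commute (e u i) (conjG u j • e u i) := by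
  have hgap : gap j i = 1 := by rw [gap]; omega
  have hfirst : ¬IsFirstPair j i := by rw [IsFirstPair]; omega
  rw [← commute_smul_smul_iff (conjG u i), conjG_smul_e u (Or.inl (by simp [gap])),
    conjG_smul_conjG_smul_e u hgap hfirst]
  exact e_mul_e_comm u i j

theorem commute_e_tie_of_lt (hi : i.val ≤ 1) (hab : a < b) : Commute (e u i) (tie u a b) := by
  induction b using Fin.induction with
  | zero => exact absurd hab (Fin.not_lt_zero a)
  | succ j ih =>
    rcases (Fin.le_castSucc_iff.2 hab).eq_or_lt with rfl | hlt
    · rw [tie_castSucc_succ]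
      exact e_mul_e_comm u i j
    rcases eq_or_ne a 0 with rfl | ha
    · rw [tie_zero_succ]
      exact e_mul_f_comm u i j
    have haj : a.val < j.val := hlt
    have ha' : a.val ≠ 0 := Fin.val_ne_of_ne ha
    rw [tie_succ u hlt]
    by_cases hij : j.val = i.val + 1
    · obtain rfl : a = i.castSucc := Fin.ext (show a.val = i.val by omega)
      rw [castSucc_eq_succ hij, tie_castSucc_succ]
      exact commute_e_conjG_smul_e u ha' hij
    · rw [← conjG_smul_e u (i := j) (j := i) (Or.inl (by rw [gap]; omega)), commute_smul_smul_iff]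
      exact ih hlt

theorem commute_tie (a b c d : Fin (n + 1)) : Commute (tie u a b) (tie u c d) := by
  induction a, b using bSwap_pair_induction generalizing c d with
  | refl a => rw [tie_self]; exact Commute.one_left _
  | symm a b h => rw [tie_comm]; exact h c d
  | bSwap i a b h =>
    obtain ⟨c, rfl⟩ := (bSwap i).surjective c
    obtain ⟨d, rfl⟩ := (bSwap i).surjective d
    rw [← conjG_smul_tie, ← conjG_smul_tie, commute_smul_smul_iff]
    exact h c d
  | adj i hi =>
    rw [tie_castSucc_succ]
    rcases lt_trichotomy c d with hcd | rfl | hcd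
    · exact commute_e_tie_of_lt u hi hcd
    · rw [tie_self]; exact Commute.one_right _
    · rw [tie_comm]; exact commute_e_tie_of_lt u hi hcd

theorem e_mul_tie_castSucc_succ (hij : j.val = i.val + 1) :
    e u i * tie u i.castSucc j.succ = e u i * e u j := by
  by_cases hi : i.val = 0
  · rw [show i.castSucc = 0 from Fin.ext hi, tie_zero_succ, e_mul_e_comm, ← f_eq_e u hi,
      e_mul_f_pred_eq_f_mul_f u hij, f_mul_f_comm]
  · rw [tie_succ u (show i.val < j.val by omega), castSucc_eq_succ hij, tie_castSucc_succ,
      e_mul_conjG_smul_e u (by rw [gap]; omega) (by rw [IsFirstPair]; omega)]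

theorem e_mul_tie_succ_of_le (hi : i.succ ≤ b) :
    e u i * tie u i.succ b = e u i * tie u i.castSucc b := by
  induction b using Fin.induction with
  | zero => exact absurd hi (Fin.succ_pos i).not_ge
  | succ j ih =>
    rcases hi.eq_or_lt with hij | hlt
    · obtain rfl := Fin.succ_injective _ hij
      rw [tie_self, mul_one, tie_castSucc_succ, e_mul_self]
    rcases (Fin.le_castSucc_iff.2 hlt).eq_or_lt with hij | hlt'
    · rw [hij, tie_castSucc_succ, e_mul_tie_castSucc_succ u (congrArg Fin.val hij).symm]
    · have hij : i.val + 1 < j.val := hlt'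
      rw [tie_succ u hlt', tie_succ u (Fin.castSucc_lt_succ.trans hlt'),
        ← conjG_smul_e u (i := j) (j := i) (Or.inl (by rw [gap]; omega)), ← smul_mul', ih hlt'.le,
        smul_mul']

theorem e_mul_tie_succ (hi : i.val ≤ 1) (b : Fin (n + 1)) :
    e u i * tie u i.succ b = e u i * tie u i.castSucc b := by
  rcases le_or_gt i.succ b with hib | hib
  · exact e_mul_tie_succ_of_le u hib
  rcases (Fin.le_castSucc_iff.2 hib).eq_or_lt with rfl | hlt
  · rw [tie_self, tie_comm, tie_castSucc_succ, e_mul_self, mul_one]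
  · have hbi : b.val < i.val := hlt
    obtain ⟨k, hk⟩ : ∃ k : Fin n, i.val = k.val + 1 := ⟨⟨0, by omega⟩, show i.val = 0 + 1 by omega⟩
    obtain rfl : b = 0 := Fin.ext (show b.val = 0 by omega)
    rw [tie_comm, tie_zero_succ, tie_comm, castSucc_eq_succ hk, tie_zero_succ, e_mul_f_pred u hk]

theorem isTieFamily_tie : IsTieFamily (tie u) where
  self := tie_self u
  symm := tie_comm u
  commute := commute_tie u
  triangle a b := by
    induction a, b using bSwap_pair_induction with
    | refl a => intro c; rfl
    | symm a b h => intro c; rw [tie_comm u b a, h]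
    | bSwap i a b h =>
      intro c
      obtain ⟨c, rfl⟩ := (bSwap i).surjective c
      simp only [← conjG_smul_tie, ← smul_mul', h]
    | adj i hi =>
      intro c
      rw [tie_castSucc_succ, e_mul_tie_succ u hi]

theorem prod_alternatingWord_map_g (i j : Fin n) :
    ((CoxeterSystem.alternatingWord i j (typeB n i j)).map (g u)).prod =
      ((CoxeterSystem.alternatingWord j i (typeB n i j)).map (g u)).prod := by
  rcases (by rw [gap, Fin.ext_iff]; omega : i = j ∨ gap i j = 1 ∨ 1 < gap i j) with
    rfl | hgap | hgap
  · rfl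
  · by_cases hfirst : IsFirstPair i j
    · rw [typeB_eq_four hfirst, prod_alternatingWord_four, prod_alternatingWord_four]
      rcases hfirst with ⟨hi, hj⟩ | ⟨hi, hj⟩
      · exact g_mul_g_mul_g_mul_g u hi hj
      · exact (g_mul_g_mul_g_mul_g u hj hi).symm
    · rw [typeB_eq_three hgap hfirst, prod_alternatingWord_three, prod_alternatingWord_three,
        g_mul_g_mul_g u hgap hfirst]
  · rw [typeB_eq_two hgap, prod_alternatingWord_two, prod_alternatingWord_two,
      g_mul_g_comm u hgap]

theorem isBraidTieSystem : IsBraidTieSystem u (g u) (tie u) where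
  toIsTieFamily := isTieFamily_tie u
  braid := prod_alternatingWord_map_g u
  quadratic i := by rw [tie_castSucc_succ, g_mul_g_self]
  mul_tie i a b := (conjG_smul_eq_iff u).1 (conjG_smul_tie u i a b)

end FloresAlgebra

/-! ## The isomorphism -/

theorem FloresAlgebra.algHom_ext {n : ℕ} {R : Type u} [CommRing R] {H : Type v} [Ring H]
    [Algebra R H] {u : Fin n → Rˣ} {φ ψ : FloresAlgebra u →ₐ[R] H}
    (hg : ∀ i, φ (g u i) = ψ (g u i)) (he : ∀ i, φ (e u i) = ψ (e u i))
    (hf : ∀ i, φ (f u i) = ψ (f u i)) : φ = ψ := by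
  refine RingQuot.ringQuot_ext' R _ _ (FreeAlgebra.hom_ext (funext fun p => ?_))
  cases p with
  | g i => exact hg i
  | e i => exact he i
  | f i => exact hf i

theorem JuyumayaMap.adjoin_g_tie_fTie_eq_top {n : ℕ} {W : Type v} [Group W] {U : Type w} [Group U]
    {cs : CoxeterSystem (typeB n) W} {ct : CoxeterSystem (CoxeterMatrix.A n) U}
    (J : JuyumayaMap cs ct) {R : Type y} [CommRing R] (u : Fin n → Rˣ)
    (hu : ∀ (g : W) (s t : Fin n), g * cs.simple s * g⁻¹ = cs.simple t → u s = u t) :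
    Algebra.adjoin R (Set.range (fun i => (J.marinDatum u hu).g i) ∪
      Set.range (fun i => J.tieImage u hu (J.tie i)) ∪
      Set.range (fun i => J.tieImage u hu (fTie J i))) = ⊤ :=
  top_unique <| (J.adjoin_g_tie_eq_top u hu).ge.trans <|
    Algebra.adjoin_mono Set.subset_union_left

namespace IsBtoA

variable {n : ℕ} {W : Type v} [Group W] {U : Type w} [Group U]
variable {cs : CoxeterSystem (typeB n) W} {ct : CoxeterSystem (CoxeterMatrix.A n) U}
variable {J : JuyumayaMap cs ct} (hJ : IsBtoA J) {R : Type y} [CommRing R] (u : Fin n → Rˣ)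
  (hu : ∀ (g : W) (s t : Fin n), g * cs.simple s * g⁻¹ = cs.simple t → u s = u t)

/-- The homomorphism from the Marin ring to Flores' algebra that sends ties to ties. -/
def marinToFlores : (J.marinDatum u hu).MarinRing →ₐ[R] FloresAlgebra u :=
  (FloresAlgebra.isBraidTieSystem u).marinLift hJ hu

/-- The homomorphism from Flores' algebra to the Marin ring that sends ties to ties. -/
def floresToMarin : FloresAlgebra u →ₐ[R] (J.marinDatum u hu).MarinRing :=
  (hJ.isBraidTieSystem_marinDatum u hu).floresLift

theorem marinToFlores_g (i : Fin n) :
    hJ.marinToFlores u hu ((J.marinDatum u hu).g i) = FloresAlgebra.g u i :=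
  (FloresAlgebra.isBraidTieSystem u).marinLift_g hJ hu i

theorem marinToFlores_tie (i : Fin n) :
    hJ.marinToFlores u hu (J.tieImage u hu (J.tie i)) = FloresAlgebra.e u i := by
  rw [hJ.tie_eq_pairTie, marinToFlores, IsBraidTieSystem.marinLift_tieImage,
    FloresAlgebra.tie_castSucc_succ]

theorem marinToFlores_fTie (i : Fin n) :
    hJ.marinToFlores u hu (J.tieImage u hu (fTie J i)) = FloresAlgebra.f u i := by
  rw [hJ.fTie_eq_pairTie, marinToFlores, IsBraidTieSystem.marinLift_tieImage,
    FloresAlgebra.tie_zero_succ]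

theorem floresToMarin_g (i : Fin n) :
    hJ.floresToMarin u hu (FloresAlgebra.g u i) = (J.marinDatum u hu).g i :=
  (hJ.isBraidTieSystem_marinDatum u hu).floresLift_g i

theorem floresToMarin_e (i : Fin n) :
    hJ.floresToMarin u hu (FloresAlgebra.e u i) = J.tieImage u hu (J.tie i) := by
  rw [floresToMarin, IsBraidTieSystem.floresLift_e, hJ.tie_eq_pairTie]

theorem floresToMarin_f (i : Fin n) :
    hJ.floresToMarin u hu (FloresAlgebra.f u i) = J.tieImage u hu (fTie J i) := by
  rw [floresToMarin, IsBraidTieSystem.floresLift_f, hJ.fTie_eq_pairTie]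

/-- The isomorphism of the Marin ring with Flores' algebra. -/
def marinEquivFlores : (J.marinDatum u hu).MarinRing ≃ₐ[R] FloresAlgebra u :=
  AlgEquiv.ofAlgHom (hJ.marinToFlores u hu) (hJ.floresToMarin u hu)
    (FloresAlgebra.algHom_ext
      (fun i => by rw [AlgHom.comp_apply, floresToMarin_g, marinToFlores_g, AlgHom.id_apply])
      (fun i => by rw [AlgHom.comp_apply, floresToMarin_e, marinToFlores_tie, AlgHom.id_apply])
      (fun i => by rw [AlgHom.comp_apply, floresToMarin_f, marinToFlores_fTie, AlgHom.id_apply]))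
    (AlgHom.ext_of_adjoin_eq_top (J.adjoin_g_tie_eq_top u hu) (by
      rintro _ (⟨i, rfl⟩ | ⟨i, rfl⟩)
      · rw [AlgHom.comp_apply, marinToFlores_g, floresToMarin_g, AlgHom.id_apply]
      · rw [AlgHom.comp_apply, marinToFlores_tie, floresToMarin_e, AlgHom.id_apply]))

end IsBtoA

end BraidsTies

end

theorem mainTheorem5 {R : Type*} [CommRing R] {W U : Type*} [Group W] [Group U] (n : ℕ)
    (cs : CoxeterSystem (BraidsTies.typeB n) W)
    (ct : CoxeterSystem (CoxeterMatrix.A n) U) :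
    (∃! J : BraidsTies.JuyumayaMap cs ct, BraidsTies.IsBtoA J) ∧
    ∀ J : BraidsTies.JuyumayaMap cs ct, BraidsTies.IsBtoA J →
      (∀ i : Fin n, J.e i = BraidsTies.rankOne ct i) ∧
      ∀ (u : Fin n → Rˣ)
        (hu : ∀ (g : W) (s t : Fin n), g * cs.simple s * g⁻¹ = cs.simple t → u s = u t),
        Algebra.adjoin R
            (Set.range (fun i : Fin n => (J.marinDatum u hu).g i) ∪
              Set.range (fun i : Fin n => J.tieImage u hu (J.tie i)) ∪
              Set.range (fun i : Fin n => J.tieImage u hu (BraidsTies.fTie J i))) = ⊤ ∧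
        ∃ Θ : (J.marinDatum u hu).MarinRing ≃ₐ[R] BraidsTies.FloresAlgebra u,
          ∀ i : Fin n,
            Θ ((J.marinDatum u hu).g i) = BraidsTies.FloresAlgebra.g u i ∧
            Θ (J.tieImage u hu (J.tie i)) = BraidsTies.FloresAlgebra.e u i ∧
            Θ (J.tieImage u hu (BraidsTies.fTie J i)) = BraidsTies.FloresAlgebra.f u i :=
  ⟨BraidsTies.existsUnique_isBtoA cs ct, fun J hJ => ⟨hJ.e_eq_rankOne, fun u hu =>
    ⟨J.adjoin_g_tie_fTie_eq_top u hu, hJ.marinEquivFlores u hu, fun i =>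
      ⟨hJ.marinToFlores_g u hu i, hJ.marinToFlores_tie u hu i, hJ.marinToFlores_fTie u hu i⟩⟩⟩⟩
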